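/- Let $k$ be an algebraically closed field, let $n$ be a positive integer that is nonzero in $k$, let $\rho_1,\dots,\rho_r\in k$ be distinct, and let $l_1,\dots,l_r$ be positive integers with $n\mid \sum_i l_i$, such that $Y^n-f(x)$ is irreducible over $k(x)$, where $f(x)=\prod_{i=1}^r (x-\rho_i)^{l_i}$. Let $X$ be the smooth projective curve over $k$ with function field $F=k(x)[Y]/(Y^n-f(x))$, let $y\in F$ be the class of $Y$ (so $y^n=f(x)$), and let $\pi:X\to\mathbb P^1$ be the morphism given by $x$. For $1\le i\le r$ put $g_i=\gcd(n,l_i)$, $e_i=n/g_i$, $\lambda_i=l_i/g_i$. For $1\le\mu\le n-1$ write $\mu\lambda_i=m_i^{(\mu)}e_i+\upsilon_i^{(\mu)}$ with $0\le\upsilon_i^{(\mu)}\le e_i-1$, and put $$g_\mu(x)=\prod_{i=1}^r(x-\rho_i)^{m_i^{(\mu)}},\qquad t^{(\mu)}=\frac1n\sum_{i=1}^r g_i\,\upsilon_i^{(\mu)}.$$ Let $I$ be the set of pairs $(\mu,\nu)$ of integers with $1\le\mu\le n-1$ and $1\le\nu\le t^{(\mu)}-1$. For $a\in\mathbb P^1(k)$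 put $U_a=X\setminus\pi^{-1}(a)$, and describe $H^1(X,\mathcal O_X)$ by the Čech complex of the covering $X=U_0\cup U_\infty$: $$H^1(X,\mathcal O_X)=\mathcal O_X(U_0\cap U_\infty)\,/\,\{f_0-f_\infty : f_0\in\mathcal O_X(U_0),\ f_\infty\in\mathcal O_X(U_\infty)\}.$$ Then: 1. The formula $$\langle\omega,[h]\rangle=-\frac1n\sum_{P\in\pi^{-1}(\infty)}\mathrm{Res}_P(h\,\omega)$$ gives a well-defined $k$-bilinear pairing $H^0(X,\Omega_X)\times H^1(X,\mathcal O_X)\to k$. 2. The differentials $$\omega_{\mu,\nu}=x^{\nu-1}\frac{g_\mu(x)}{y^\mu}\,dx,\qquad(\mu,\nu)\in I,$$ are holomorphic and form a $k$-basis of $H^0(X,\Omega_X)$. 3. The functions $\frac{y^\mu}{x^\nu g_\mu(x)}$, $(\mu,\nu)\in I$, lie in $\mathcal O_X(U_0\cap U_\infty)$, and their classes $h_{\mu,\nu}=\left[\frac{y^\mu}{x^\nu g_\mu(x)}\right]$ form a $k$-basis of $H^1(X,\mathcal O_X)$. 4. These bases are dual to each other: for all $(\mu_1,\nu_1),(\mu_2,\nu_2)\in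 I$, $$\langle\omega_{\mu_1,\nu_1},h_{\mu_2,\nu_2}\rangle=\delta_{\mu_1,\mu_2}\,\delta_{\nu_1,\nu_2}.$$ -/

import Mathlib

open Polynomial KaehlerDifferential

noncomputable section

namespace KummerCurve

/-! ### Curves through their function fields

For a function field `F` of one variable over an algebraically closed field `k`, the points of the
smooth projective curve `X` with function field `F` are the places of `F / k`. -/

section Curve

/-- A place of `F / k`: a valuation ring of `F`, different from `F`, that contains `k`.
The valuation ring is the local ring `𝒪_{X,P}` of the corresponding point `P`. -/
@[ext]
structure Place (k F : Type*) [Field k] [Field F] [Algebra k F] where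
  /-- the local ring at the point -/
  ring : ValuationSubring F
  algebraMap_mem : ∀ a : k, algebraMap k F a ∈ ring
  ne_top : ring ≠ ⊤

variable {k F : Type*} [Field k] [Field F] [Algebra k F]

/-- `π⁻¹(a)`, for `a ∈ ℙ¹(k) = k ∪ {∞}` and the morphism `π : X → ℙ¹` given by the function `x`:
for `a ∈ k`, the points at which `x - a` vanishes; for `a = ∞`, the poles of `x`. -/
def fiber (x : F) (a : OnePoint k) : Set (Place k F) :=
  a.elim {P | x ∉ P.ring} (fun c => {P | x - algebraMap k F c ∈ P.ring.nonunits})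

/-- `U_a = X ∖ π⁻¹(a)`. -/
def U (x : F) (a : OnePoint k) : Set (Place k F) := (fiber x a)ᶜ

/-- `𝒪_X(V)`: the rational functions on `X` that are regular at each point of `V`. -/
def regularFunctions (V : Set (Place k F)) : Submodule k F where
  carrier := {f | ∀ P ∈ V, f ∈ P.ring}
  add_mem' hf hg P hP := add_mem (hf P hP) (hg P hP)
  zero_mem' P _ := zero_mem P.ring
  smul_mem' c f hf P hP := by
    rw [Algebra.smul_def]
    exact mul_mem (P.algebraMap_mem c) (hf P hP)

/-- The stalk of `Ω_X` at `P`, inside the rational differentials: the sums of `a db` with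
`a, b ∈ 𝒪_{X,P}`. -/
def differentialStalk (P : Place k F) : Submodule k Ω[F⁄k] :=
  Submodule.span k {η | ∃ a ∈ P.ring, ∃ b ∈ P.ring, η = a • D k F b}

variable (k F) in
/-- `H⁰(X, Ω_X)`: the rational differentials that are regular at every point of `X`. -/
def holomorphicDifferentials : Submodule k Ω[F⁄k] :=
  ⨅ P : Place k F, differentialStalk P

/-- The subspace `{f₀ - f_∞ : f₀ ∈ 𝒪_X(V), f_∞ ∈ 𝒪_X(W)}` of `𝒪_X(V ∩ W)`. -/
def cechCoboundaries (V W : Set (Place k F)) : Submodule k (regularFunctions (V ∩ W)) where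
  carrier := {f | ∃ f₀ ∈ regularFunctions V, ∃ f₁ ∈ regularFunctions W, (f : F) = f₀ - f₁}
  add_mem' := by
    rintro f g ⟨a, ha, b, hb, h⟩ ⟨c, hc, d, hd, h'⟩
    refine ⟨a + c, add_mem ha hc, b + d, add_mem hb hd, ?_⟩
    rw [Submodule.coe_add, h, h']
    ring
  zero_mem' := ⟨0, zero_mem _, 0, zero_mem _, by simp⟩
  smul_mem' := by
    rintro s f ⟨a, ha, b, hb, h⟩
    refine ⟨s • a, Submodule.smul_mem _ s ha, s • b, Submodule.smul_mem _ s hb, ?_⟩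
    rw [Submodule.coe_smul, h, smul_sub]

/-- `U_0 ∩ U_∞`. -/
abbrev overlap (x : F) : Set (Place k F) :=
  U x ((0 : k) : OnePoint k) ∩ U x (OnePoint.infty : OnePoint k)

/-- `H¹(X, 𝒪_X)` as the Čech cohomology group of the covering `X = U_0 ∪ U_∞`. -/
abbrev CechH1 (x : F) : Type _ :=
  regularFunctions (overlap (k := k) x) ⧸
    cechCoboundaries (U x ((0 : k) : OnePoint k)) (U x (OnePoint.infty : OnePoint k))

/-- The class `[h] ∈ H¹(X, 𝒪_X)` of `h ∈ 𝒪_X(U_0 ∩ U_∞)`. -/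
def cechClass (x : F) :
    regularFunctions (overlap (k := k) x) →ₗ[k]
      CechH1 (k := k) x :=
  Submodule.mkQ _

/-- A local uniformizer `t` at `P`, with the Laurent expansion `F → k((t))` at `P`:
the embedding of `k`-algebras that sends `t` to the variable and under which the local ring at `P`
consists of the functions whose expansion is a power series. -/
structure LocalExpansion (P : Place k F) where
  /-- the uniformizer -/
  t : F
  /-- the Laurent expansion of a rational function -/
  expand : F →ₐ[k] LaurentSeries k
  expand_t : expand t = HahnSeries.single (1 : ℤ) (1 : k)
  mem_ring_iff : ∀ f : F, f ∈ P.ring ↔ expand f ∈ Set.range (HahnSeries.ofPowerSeries ℤ k)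

/-- `c` is the coefficient `c₋₁` of the Laurent expansion of `g` at `P`, for some decomposition
`ω = g dt` with a local uniformizer `t` at `P`. -/
def HasResidue (P : Place k F) (ω : Ω[F⁄k]) (c : k) : Prop :=
  ∃ (e : LocalExpansion P) (g : F), ω = g • D k F e.t ∧ c = (e.expand g).coeff (-1)

open Classical in
/-- `Res_P(ω)`. (On a curve over an algebraically closed field the residue exists and does not
depend on the uniformizer; the value `0` is only a default outside that situation.) -/
def residue (P : Place k F) (ω : Ω[F⁄k]) : k :=
  if h : ∃ c, HasResidue P ω c then h.choose else 0

end Curve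

/-! ### The Kummer curve `y ^ n = f(x) = ∏ (x - ρ i) ^ (l i)` -/

section Kummer

variable {k : Type*} [Field k] {r : ℕ}

/-- `f = ∏ (x - ρ i) ^ (l i)`. -/
def f (ρ : Fin r → k) (l : Fin r → ℕ) : k[X] := ∏ i, (X - C (ρ i)) ^ l i

/-- The polynomial `Y ^ n - f(x)` over `k(x)`. -/
def equation (n : ℕ) (ρ : Fin r → k) (l : Fin r → ℕ) : (RatFunc k)[X] :=
  X ^ n - C (algebraMap k[X] (RatFunc k) (f ρ l))

/-- The function field `F = k(x)[Y] / (Y ^ n - f(x))` of the Kummer curve. -/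
def FunctionField (n : ℕ) (ρ : Fin r → k) (l : Fin r → ℕ) : Type _ :=
  AdjoinRoot (equation n ρ l)

instance fieldFunctionField (n : ℕ) (ρ : Fin r → k) (l : Fin r → ℕ) [Fact (Irreducible (equation n ρ l))] :
    Field (FunctionField n ρ l) :=
  inferInstanceAs (Field (AdjoinRoot (equation n ρ l)))

instance algebraRatFunc (n : ℕ) (ρ : Fin r → k) (l : Fin r → ℕ) [Fact (Irreducible (equation n ρ l))] :
    Algebra (RatFunc k) (FunctionField n ρ l) :=
  inferInstanceAs (Algebra (RatFunc k) (AdjoinRoot (equation n ρ l)))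

instance algebraFunctionField (n : ℕ) (ρ : Fin r → k) (l : Fin r → ℕ) [Fact (Irreducible (equation n ρ l))] :
    Algebra k (FunctionField n ρ l) :=
  inferInstanceAs (Algebra k (AdjoinRoot (equation n ρ l)))

/-- The function `x` on the curve. -/
def x (n : ℕ) (ρ : Fin r → k) (l : Fin r → ℕ) : FunctionField n ρ l :=
  AdjoinRoot.of (equation n ρ l) RatFunc.X

/-- The function `y` on the curve. -/
def y (n : ℕ) (ρ : Fin r → k) (l : Fin r → ℕ) : FunctionField n ρ l :=
  AdjoinRoot.root (equation n ρ l)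

/-- `g_i = gcd(n, l_i)`, the number of points above `x = ρ_i`. -/
def gNum (n : ℕ) (l : Fin r → ℕ) (i : Fin r) : ℕ := Nat.gcd n (l i)

/-- `e_i = n / gcd(n, l_i)`, the ramification index above `x = ρ_i`. -/
def e (n : ℕ) (l : Fin r → ℕ) (i : Fin r) : ℕ := n / gNum n l i

/-- `λ_i = l_i / gcd(n, l_i)`. -/
def lam (n : ℕ) (l : Fin r → ℕ) (i : Fin r) : ℕ := l i / gNum n l i

/-- `m_i^{(μ)}`: the quotient in the division of `μ λ_i` by `e_i`. -/
def m (n : ℕ) (l : Fin r → ℕ) (μ : ℕ) (i : Fin r) : ℕ := μ * lam n l i / e n l i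

/-- `υ_i^{(μ)}`: the remainder in the division of `μ λ_i` by `e_i`. -/
def upsilon (n : ℕ) (l : Fin r → ℕ) (μ : ℕ) (i : Fin r) : ℕ := μ * lam n l i % e n l i

/-- `t^{(μ)} = (1 / n) ∑ g_i υ_i^{(μ)}`. The sum is `μ ∑ l_i - n ∑ m_i^{(μ)}`, so the division
is exact when `n ∣ ∑ l_i`. -/
def t (n : ℕ) (l : Fin r → ℕ) (μ : ℕ) : ℕ := (∑ i, gNum n l i * upsilon n l μ i) / n

/-- `g_μ = ∏ (x - ρ_i) ^ m_i^{(μ)}`. -/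
def g (n : ℕ) (ρ : Fin r → k) (l : Fin r → ℕ) (μ : ℕ) : k[X] :=
  ∏ i, (X - C (ρ i)) ^ m n l μ i

/-- The pairs `(μ, ν)` with `1 ≤ μ ≤ n - 1` and `1 ≤ ν ≤ t^{(μ)} - 1` (so that `t^{(μ)} ≥ 2`). -/
abbrev Index (n : ℕ) (l : Fin r → ℕ) : Type :=
  {p : ℕ × ℕ // (1 ≤ p.1 ∧ p.1 < n) ∧ (1 ≤ p.2 ∧ p.2 < t n l p.1)}

/-- `ω_{μ,ν} = x ^ (ν - 1) g_μ(x) / y ^ μ dx`. -/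
def omega (n : ℕ) (ρ : Fin r → k) (l : Fin r → ℕ) [Fact (Irreducible (equation n ρ l))]
    (μ ν : ℕ) : Ω[FunctionField n ρ l⁄k] :=
  (x n ρ l ^ (ν - 1) * aeval (x n ρ l) (g n ρ l μ) / y n ρ l ^ μ) •
    D k (FunctionField n ρ l) (x n ρ l)

/-- The function `y ^ μ / (x ^ ν g_μ(x))`, whose class is `h_{μ,ν}`. -/
def hFun (n : ℕ) (ρ : Fin r → k) (l : Fin r → ℕ) [Fact (Irreducible (equation n ρ l))]
    (μ ν : ℕ) : FunctionField n ρ l :=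
  y n ρ l ^ μ / (x n ρ l ^ ν * aeval (x n ρ l) (g n ρ l μ))

end Kummer

end KummerCurve

end

/-! Everything is computed in Laurent expansions, that is, in `k`-embeddings `F → k((T))`. Above a
finite point `c` one takes `x = c + T ^ e` and `y = T ^ λ · unit`. Above `∞` one takes `x = T⁻¹` and
`y = T ^ (-L) · unit` with `L = (∑ l i) / n`. The unit is an `n`-th root supplied by Hensel's lemma,
since `n ≠ 0` in `k` (`exists_finiteGerm`, `exists_infiniteGerm`).

The automorphisms `y ↦ ζ y`, `ζ ^ n = 1`, permute the points of each fibre. Averaging over `ζ`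
projects `∑ a_j(x) y ^ j` to a single term, so regularity along a fibre can be tested term by term
(`mem_integers_component`). For one term it is an inequality between orders. At finite points this
inequality says that `a_j g_j`, respectively `a_j / g_j` for the differential `a_j y ^ (-j) dx`, has
no pole. At `∞` it is a degree bound, and `μ L = deg g_μ + t^{(μ)}` (`degree_identity`) puts it in
terms of `t^{(μ)}`. Hence the `ω_{μ,ν}` span the holomorphic differentials. A function on the
overlap is a combination of monomials `x ^ j y ^ μ / g_μ`; those with `j ≥ 0` or `j ≤ -t^{(μ)}` are
coboundaries, and the others are the `h_{μ,ν}`.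

The pairing kills functions regular above `∞`, because there `h ω` has no pole. For `h` regular at
all finite points, the sum over `ζ` leaves only the `y ^ 0` component of `h ω`, which is `p(x) dx`
with `p` a polynomial and so has no residue at `∞`; the general residue theorem is not needed. The
duality relations are a direct computation with monomials, and they give the linear independence of
both families.

Two facts tie this to the definitions: the residue does not depend on the uniformizer, in any
characteristic (`HasResidue.eq_coeff`), and the points above `∞` correspond to the `n`-th roots of
unity (`InfiniteGerm.image_place`). -/

open Polynomial KaehlerDifferential

noncomputable section

/-! ### Power series: `n`-th roots and the universal residue identity. -/

namespace PowerSeries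

/-- Hensel's lemma for `W ^ n = F` in `k⟦X⟧`. -/
theorem exists_pow_eq {k : Type*} [Field k] (n : ℕ) (hn : (n : k) ≠ 0) (F : k⟦X⟧) (b : k)
    (hb : b ≠ 0) (hF : b ^ n = constantCoeff F) :
    ∃ w : k⟦X⟧, constantCoeff w = b ∧ w ^ n = F := by
  -- Newton approximations: pairs `(N, s)` where `s` is an `n`-th root of `F` modulo `X ^ (N + 1)`.
  let T := {s : ℕ × k⟦X⟧ // (X : k⟦X⟧) ^ (s.1 + 1) ∣ s.2 ^ n - F ∧ constantCoeff s.2 = b}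
  have step : ∀ s : T, ∃ s' : T, s'.1.1 = s.1.1 + 1 ∧ (X : k⟦X⟧) ^ (s.1.1 + 1) ∣ s'.1.2 - s.1.2 := by
    rintro ⟨⟨N, s⟩, ⟨D, hD⟩, hs⟩
    have hnb : (n : k) * b ^ (n - 1) ≠ 0 := mul_ne_zero hn (pow_ne_zero _ hb)
    -- The correction `c X ^ (N + 1)` solves the linearised equation; its slope `n b ^ (n - 1)` is
    -- invertible.
    obtain ⟨c, hc⟩ : ∃ c : k, (n : k) * b ^ (n - 1) * c + constantCoeff D = 0 :=
      ⟨-constantCoeff D / (n * b ^ (n - 1)), by field_simp; ring⟩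
    refine ⟨⟨(N + 1, s + C c * X ^ (N + 1)), ?_, by simpa using hs⟩, rfl, by simp⟩
    obtain ⟨q, hq⟩ := Polynomial.powAddExpansion s (C c * (X : k⟦X⟧) ^ (N + 1)) n
    simp only at hD hq ⊢
    have h1 : (X : k⟦X⟧) ∣ n * s ^ (n - 1) * C c + D := by
      rw [X_dvd_iff]
      simpa [hs] using hc
    obtain ⟨E, hE⟩ := h1
    refine ⟨E + q * (C c) ^ 2 * X ^ N, ?_⟩
    rw [hq]
    linear_combination hD + (X : k⟦X⟧) ^ (N + 1) * hE
  choose nxt hnxt1 hnxt2 using step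
  let s : ℕ → T := fun N => nxt^[N] ⟨(0, C b), by
    rw [zero_add, pow_one, X_dvd_iff]; simp [hF], by simp⟩
  have hs1 : ∀ N, (s N).1.1 = N := by
    intro N
    induction N with
    | zero => rfl
    | succ N ih => simp only [s, Function.iterate_succ_apply'] at ih ⊢; rw [hnxt1, ih]
  have hs2 : ∀ N, (X : k⟦X⟧) ^ (N + 1) ∣ (s (N + 1)).1.2 - (s N).1.2 := by
    intro N
    have := hnxt2 (s N)
    rw [hs1] at this
    simpa only [s, Function.iterate_succ_apply'] using this
  have hs3 : ∀ N j, (X : k⟦X⟧) ^ (N + 1) ∣ (s (N + j)).1.2 - (s N).1.2 := by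
    intro N j
    induction j with
    | zero => simp
    | succ j ih =>
      have := dvd_add ((pow_dvd_pow (X : k⟦X⟧) (by omega : N + 1 ≤ N + j + 1)).trans (hs2 (N + j))) ih
      rw [sub_add_sub_cancel] at this
      exact this
  -- The limit is read off diagonally: the coefficient of `X ^ i` is stable from stage `i` on.
  let w : k⟦X⟧ := mk fun i => coeff i (s i).1.2
  have hw : ∀ N, (X : k⟦X⟧) ^ (N + 1) ∣ w - (s N).1.2 := by
    intro N
    rw [X_pow_dvd_iff]
    intro i hi
    obtain ⟨j, rfl⟩ := Nat.exists_eq_add_of_le (Nat.lt_succ_iff.mp hi)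
    have := X_pow_dvd_iff.mp (hs3 i j) i (by omega)
    rw [map_sub, sub_eq_zero] at this ⊢
    rw [this, coeff_mk]
  refine ⟨w, ?_, ?_⟩
  · have := X_pow_dvd_iff.mp (hw 0) 0 (by omega)
    rw [map_sub, sub_eq_zero, coeff_zero_eq_constantCoeff_apply, coeff_zero_eq_constantCoeff_apply,
      (s 0).2.2] at this
    exact this
  · ext N
    have h1 := (hw N).trans (sub_dvd_pow_sub_pow w (s N).1.2 n)
    have h2 := (s N).2.1
    rw [hs1] at h2
    have h3 := X_pow_dvd_iff.mp (dvd_add h1 h2) N (by omega)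
    rw [sub_add_sub_cancel, map_sub, sub_eq_zero] at h3
    exact h3

/-- For `u = X w` this is the residue of `u ^ (-q - 1) du`. If `q > 0`, then `q` times the series is
`q v ^ q - X (v ^ q)'`, whose coefficient at `X ^ q` cancels; characteristic zero permits division
by `q`. -/
theorem coeff_residue_of_charZero {R : Type*} [CommRing R] [IsDomain R] [CharZero R] (w v : R⟦X⟧)
    (h : w * v = 1) (q : ℕ) :
    coeff q (v ^ (q + 1) * (w + X * derivative R w)) = if q = 0 then 1 else 0 := by
  rcases Nat.eq_zero_or_pos q with rfl | hq
  · have := congrArg constantCoeff h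
    simp only [map_mul, map_one] at this
    simp [mul_comm, this]
  · rw [if_neg hq.ne']
    have hd : derivative R (v ^ q) = -(q : R⟦X⟧) * v ^ (q + 1) * derivative R w := by
      have h1 : w * derivative R v + v * derivative R w = 0 := by
        simpa using congrArg (derivative R) h
      have h2 : derivative R v = - v ^ 2 * derivative R w := by
        linear_combination v * h1 - derivative R v * h
      obtain ⟨j, rfl⟩ : ∃ j, q = j + 1 := ⟨q - 1, by omega⟩
      rw [derivative_pow, h2]
      push_cast
      simp
      ring
    have e1 : (q : R⟦X⟧) * (v ^ (q + 1) * (w + X * derivative R w)) =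
        (q : R⟦X⟧) * v ^ q - X * derivative R (v ^ q) := by
      rw [hd]
      linear_combination (q : R⟦X⟧) * v ^ q * h
    have e2 := congrArg (coeff q) e1
    obtain ⟨j, rfl⟩ : ∃ j, q = j + 1 := ⟨q - 1, by omega⟩
    rw [← nsmul_eq_mul, ← nsmul_eq_mul, map_sub, map_nsmul, map_nsmul, coeff_succ_X_mul,
      coeff_derivative, nsmul_eq_mul, nsmul_eq_mul] at e2
    push_cast at e2
    have e3 : ((j : R) + 1) * coeff (j + 1) (v ^ (j + 1 + 1) * (w + X * derivative R w)) = 0 := by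
      rw [e2]; ring
    exact (mul_eq_zero.mp e3).resolve_left (by exact_mod_cast Nat.succ_ne_zero j)

theorem derivative_map {R S : Type*} [CommRing R] [CommRing S] (φ : R →+* S) (w : R⟦X⟧) :
    derivative S (map φ w) = map φ (derivative R w) := by
  ext i; simp [coeff_derivative]

/-- Once `w` has constant term `1`, the claim is an integral polynomial identity in the coefficients
of `w`, so it specialises from characteristic zero to any field. -/
theorem coeff_residue {k : Type*} [Field k] (w : k⟦X⟧) (hw : constantCoeff w ≠ 0) (q : ℕ) :
    coeff q (w⁻¹ ^ (q + 1) * (w + X * derivative k w)) = if q = 0 then 1 else 0 := by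
  have key : ∀ w : k⟦X⟧, constantCoeff w = 1 →
      coeff q (w⁻¹ ^ (q + 1) * (w + X * derivative k w)) = if q = 0 then 1 else 0 := by
    intro w hw
    -- `MvPolynomial k ℤ` has one variable for each element of `k`, and `φ` sends the variable of
    -- `a` to `a`. It is a domain of characteristic zero over which `w` lifts.
    let φ : MvPolynomial k ℤ →+* k := MvPolynomial.eval₂Hom (Int.castRingHom k) id
    let W : (MvPolynomial k ℤ)⟦X⟧ :=
      mk fun i => if i = 0 then 1 else MvPolynomial.X (coeff i w)
    have hWw : map φ W = w := by
      ext i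
      rcases eq_or_ne i 0 with rfl | hi
      · simp [W, hw]
      · simp [W, φ, hi]
    have hV := mul_invOfUnit W 1 (by simp [W])
    have h := congrArg φ (coeff_residue_of_charZero W (invOfUnit W 1) hV q)
    have hinv : map φ (invOfUnit W 1) = w⁻¹ := by
      rw [PowerSeries.eq_inv_iff_mul_eq_one (by rw [hw]; exact one_ne_zero), mul_comm]
      have := congrArg (map φ) hV
      rwa [map_mul, hWw, map_one] at this
    rw [← coeff_map, RingHom.map_mul, RingHom.map_pow, RingHom.map_add, RingHom.map_mul,
      ← derivative_map, hinv, hWw, map_X] at h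
    rw [h]
    split_ifs <;> simp
  -- Dividing `w` by its constant term `b` multiplies the series by `b ^ q`, which affects neither
  -- the value `1` at `q = 0` nor the vanishing for `q > 0`.
  set b := constantCoeff w with hb
  have h := key (C b⁻¹ * w) (by simp [← hb, hw])
  have hCC : (C b : k⟦X⟧) * C b⁻¹ = 1 := by rw [← map_mul, mul_inv_cancel₀ hw, map_one]
  have e1 : (C b⁻¹ * w)⁻¹ ^ (q + 1) * (C b⁻¹ * w + X * derivative k (C b⁻¹ * w)) =
      C (b ^ q) * (w⁻¹ ^ (q + 1) * (w + X * derivative k w)) := by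
    have : (C b⁻¹ * w)⁻¹ = C b * w⁻¹ := by
      symm
      rw [PowerSeries.eq_inv_iff_mul_eq_one (by simp [← hb, hw])]
      linear_combination (w⁻¹ * w) * hCC + PowerSeries.inv_mul_cancel w hw
    rw [this, Derivation.leibniz, derivative_C]
    simp only [smul_eq_mul, map_pow, mul_zero, add_zero]
    linear_combination (C b) ^ q * (w⁻¹ ^ (q + 1) * (w + X * derivative k w)) * hCC
  rw [e1, coeff_C_mul] at h
  rcases Nat.eq_zero_or_pos q with rfl | hq
  · simpa using h
  · rw [if_neg hq.ne'] at h ⊢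
    exact (mul_eq_zero.mp h).resolve_left (pow_ne_zero _ hw)

end PowerSeries

/-! ### Laurent series: order, the valuation ring, and `d/dT`. -/

namespace LaurentSeries

variable {k : Type*} [Field k]

theorem order_inv (h : LaurentSeries k) : h⁻¹.order = -h.order := by
  rcases eq_or_ne h 0 with rfl | h0
  · simp
  · have := HahnSeries.order_mul h0 (inv_ne_zero h0)
    rw [mul_inv_cancel₀ h0, HahnSeries.order_one] at this
    omega

theorem order_div {a b : LaurentSeries k} (ha : a ≠ 0) (hb : b ≠ 0) :
    (a / b).order = a.order - b.order := by
  rw [div_eq_mul_inv, HahnSeries.order_mul ha (inv_ne_zero hb), order_inv, sub_eq_add_neg]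

theorem order_zpow (a : LaurentSeries k) (i : ℤ) : (a ^ i).order = i * a.order := by
  rcases i with i | i
  · simp
  · rw [zpow_negSucc, order_inv, HahnSeries.order_pow, nsmul_eq_mul, Int.negSucc_eq]
    push_cast
    ring

theorem ofPowerSeries_order (w : PowerSeries k) (hw : PowerSeries.constantCoeff w ≠ 0) :
    (HahnSeries.ofPowerSeries ℤ k w).order = 0 := by
  have h0 : (HahnSeries.ofPowerSeries ℤ k w).coeff 0 ≠ 0 := by
    rw [PowerSeries.coeff_coe]; simpa using hw
  refine le_antisymm (HahnSeries.order_le_of_coeff_ne_zero h0) ?_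
  by_contra! hlt
  have h1 : HahnSeries.ofPowerSeries ℤ k w ≠ 0 := by rintro h; simp [h] at h0
  have := (HahnSeries.coeff_order_eq_zero (x := HahnSeries.ofPowerSeries ℤ k w)).not.mpr h1
  rw [PowerSeries.coeff_coe, if_pos hlt] at this
  exact this rfl

/-- The zero series has order `0` by convention, so it needs no separate clause. -/
theorem mem_range_ofPowerSeries_iff (h : LaurentSeries k) :
    h ∈ (HahnSeries.ofPowerSeries ℤ k).range ↔ 0 ≤ h.order := by
  constructor
  · rintro ⟨p, rfl⟩
    by_contra! hlt
    have h1 : HahnSeries.ofPowerSeries ℤ k p ≠ 0 := by rintro h; simp [h] at hlt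
    have := (HahnSeries.coeff_order_eq_zero (x := HahnSeries.ofPowerSeries ℤ k p)).not.mpr h1
    rw [PowerSeries.coeff_coe, if_pos hlt] at this
    exact this rfl
  · intro h0
    obtain ⟨m, hm⟩ := Int.eq_ofNat_of_zero_le h0
    exact ⟨_, X_order_mul_powerSeriesPart hm.symm⟩

variable (k) in
/-- The valuation ring `k⟦T⟧` of `k((T))`. -/
def integers : ValuationSubring (LaurentSeries k) :=
  { (HahnSeries.ofPowerSeries ℤ k).range with
    mem_or_inv_mem' := by
      intro h
      change h ∈ (HahnSeries.ofPowerSeries ℤ k).range ∨ h⁻¹ ∈ (HahnSeries.ofPowerSeries ℤ k).range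
      rw [mem_range_ofPowerSeries_iff, mem_range_ofPowerSeries_iff, order_inv]
      omega }

theorem mem_integers {h : LaurentSeries k} : h ∈ integers k ↔ 0 ≤ h.order :=
  mem_range_ofPowerSeries_iff h

theorem coeff_eq_zero_of_mem_integers {h : LaurentSeries k} (hh : h ∈ integers k) {i : ℤ}
    (hi : i < 0) : h.coeff i = 0 :=
  HahnSeries.coeff_eq_zero_of_lt_order (hi.trans_le (mem_integers.mp hh))

theorem mem_integers_of_coeff {h : LaurentSeries k} (hh : ∀ i < 0, h.coeff i = 0) :
    h ∈ integers k := by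
  rw [mem_integers]
  by_contra! hlt
  exact (HahnSeries.coeff_order_eq_zero.not.mpr (by rintro rfl; simp at hlt)) (hh _ hlt)

theorem derivative_coeff (h : LaurentSeries k) (i : ℤ) :
    (derivative k h).coeff i = (i + 1) * h.coeff (i + 1) := by
  rw [derivative_apply, hasseDeriv_coeff]
  simp

theorem algebraMap_eq_C (c : k) : algebraMap k (LaurentSeries k) c = HahnSeries.C c := by
  simp [HahnSeries.algebraMap_apply']

theorem coeff_single_mul_sub (a i : ℤ) (c : k) (h : LaurentSeries k) :
    (HahnSeries.single a c * h).coeff i = c * h.coeff (i - a) := by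
  have := HahnSeries.coeff_single_mul_add (r := c) (x := h) (a := i - a) (b := a)
  rwa [sub_add_cancel] at this

theorem derivative_single_mul (a : ℤ) (h : LaurentSeries k) :
    derivative k (HahnSeries.single a 1 * h) =
      HahnSeries.single (a - 1) (a : k) * h + HahnSeries.single a 1 * derivative k h := by
  ext i
  rw [HahnSeries.coeff_add, derivative_coeff, coeff_single_mul_sub, coeff_single_mul_sub,
    coeff_single_mul_sub, derivative_coeff, show i + 1 - a = i - a + 1 by ring,
    show i - (a - 1) = i - a + 1 by ring]
  push_cast
  ring

theorem derivative_ofPowerSeries (p : PowerSeries k) :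
    derivative k (HahnSeries.ofPowerSeries ℤ k p) =
      HahnSeries.ofPowerSeries ℤ k (PowerSeries.derivative k p) := by
  ext i
  rw [derivative_coeff, PowerSeries.coeff_coe, PowerSeries.coeff_coe]
  rcases lt_trichotomy i (-1) with hi | rfl | hi
  · rw [if_pos (by omega), if_pos (by omega), mul_zero]
  · simp
  · obtain ⟨j, rfl⟩ := Int.eq_ofNat_of_zero_le (by omega : 0 ≤ i)
    rw [if_neg (by omega), if_neg (by omega), PowerSeries.coeff_derivative,
      show ((j : ℤ) + 1).natAbs = j + 1 by omega, Int.natAbs_natCast]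
    push_cast
    ring

/-- Splitting off `T ^ order` from each factor reduces the Leibniz rule to power series and to
monomials. -/
theorem derivative_mul (a b : LaurentSeries k) :
    derivative k (a * b) = a * derivative k b + b * derivative k a := by
  rw [← single_order_mul_powerSeriesPart a, ← single_order_mul_powerSeriesPart b]
  set A := a.powerSeriesPart
  set B := b.powerSeriesPart
  have h1 : ∀ i j : ℤ, (HahnSeries.single i (1 : k)) * HahnSeries.single j 1 =
      HahnSeries.single (i + j) 1 := by simp
  rw [show ∀ s t u v : LaurentSeries k, (s * t) * (u * v) = (s * u) * (t * v) by
    intros; ring, h1, ← map_mul, derivative_single_mul, derivative_single_mul,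
    derivative_single_mul, derivative_ofPowerSeries, derivative_ofPowerSeries,
    derivative_ofPowerSeries, Derivation.leibniz, smul_eq_mul, smul_eq_mul, map_add, map_mul, map_mul, map_mul]
  have h2 : (HahnSeries.single (a.order + b.order - 1) ((a.order + b.order : ℤ) : k)) =
      HahnSeries.single a.order 1 * HahnSeries.single (b.order - 1) (b.order : k) +
      HahnSeries.single b.order 1 * HahnSeries.single (a.order - 1) (a.order : k) := by
    rw [HahnSeries.single_mul_single, HahnSeries.single_mul_single,
      show b.order + (a.order - 1) = a.order + b.order - 1 by ring,
      show a.order + (b.order - 1) = a.order + b.order - 1 by ring, ← HahnSeries.single_add]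
    push_cast
    congr 1
    ring
  rw [h2, ← h1]
  ring

theorem derivative_mem_integers {h : LaurentSeries k} (hh : h ∈ integers k) :
    derivative k h ∈ integers k := by
  refine mem_integers_of_coeff fun i hi => ?_
  rw [derivative_coeff]
  -- At index `-1` the factor `i + 1` vanishes; below it the coefficient of `h` does.
  rcases eq_or_ne i (-1) with rfl | h1
  · simp
  · rw [coeff_eq_zero_of_mem_integers hh (by omega), mul_zero]

theorem derivative_single (i : ℤ) (c : k) :
    derivative k (HahnSeries.single i c) = HahnSeries.single (i - 1) (i * c) := by
  rw [derivative_apply, show (1 : ℕ) = 1 from rfl, hasseDeriv_single]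
  simp

/-- The residue of `u ^ i du` is `1` for `i = -1` and `0` for smaller `i`, in any
characteristic. -/
theorem coeff_zpow_mul_derivative {u : LaurentSeries k} (hu : u.order = 1) {i : ℤ} (hi : i ≤ -1) :
    (u ^ i * derivative k u).coeff (-1) = if i = -1 then 1 else 0 := by
  obtain ⟨q, rfl⟩ : ∃ q : ℕ, i = -((q : ℤ) + 1) := ⟨(-i - 1).toNat, by omega⟩
  set w := u.powerSeriesPart with hw
  have hu0 : u ≠ 0 := by rintro rfl; simp at hu
  have hw0 : PowerSeries.constantCoeff w ≠ 0 := by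
    rw [← PowerSeries.coeff_zero_eq_constantCoeff_apply, hw, powerSeriesPart_coeff]
    simpa using hu0
  have huw : HahnSeries.single 1 1 * HahnSeries.ofPowerSeries ℤ k w = u := by
    have := single_order_mul_powerSeriesPart u
    rwa [hu] at this
  have hW : (HahnSeries.ofPowerSeries ℤ k w)⁻¹ = HahnSeries.ofPowerSeries ℤ k w⁻¹ := by
    apply inv_eq_of_mul_eq_one_right
    rw [← map_mul, PowerSeries.mul_inv_cancel w hw0, map_one]
  -- With `u = T w`, this is `T ^ (-(q + 1))` times the power series of `PowerSeries.coeff_residue`.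
  have e : u ^ (-((q : ℤ) + 1)) * derivative k u = HahnSeries.single (-((q : ℤ) + 1)) 1 *
      HahnSeries.ofPowerSeries ℤ k
        (w⁻¹ ^ (q + 1) * (w + PowerSeries.X * PowerSeries.derivative k w)) := by
    rw [← huw, derivative_single_mul, derivative_ofPowerSeries]
    have h1 : HahnSeries.single ((1 : ℤ) - 1) (((1 : ℤ) : k)) = 1 := by simp
    have h2 : HahnSeries.single (-((q : ℤ) + 1)) (1 : k) =
        (HahnSeries.single (1 : ℤ) (1 : k)) ^ (-((q : ℤ) + 1)) := by
      rw [RatFunc.single_zpow]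
    rw [h1, one_mul, h2, mul_zpow, zpow_neg (HahnSeries.ofPowerSeries ℤ k w), map_mul, map_add,
      map_mul, map_pow, HahnSeries.ofPowerSeries_X, ← hW, inv_pow]
    norm_cast
    ring
  rw [e, coeff_single_mul_sub, one_mul, PowerSeries.coeff_coe, if_neg (by omega),
    show (-1 - -((q : ℤ) + 1)).natAbs = q by omega, PowerSeries.coeff_residue w hw0]
  congr 1
  simp only [eq_iff_iff]
  omega

end LaurentSeries

namespace KummerCurve

/-! ### Places and differentials from embeddings in `k((T))`; independence of the residue. -/

section Germs

open LaurentSeries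

variable {k F : Type*} [Field k] [Field F] [Algebra k F]

theorem mem_nonunits_iff_inv {F : Type*} [Field F] (A : ValuationSubring F) (a : F) :
    a ∈ A.nonunits ↔ a = 0 ∨ a⁻¹ ∉ A := by
  rw [ValuationSubring.mem_nonunits_iff, ← A.valuation_le_one_iff, map_inv₀]
  rcases eq_or_ne a 0 with rfl | h0
  · simp
  · have : A.valuation a ≠ 0 := by simpa using h0
    rw [inv_le_one₀ (zero_lt_iff.mpr this), not_le]
    simp [h0]

theorem map_algebraMap_mul (ψ : F →ₐ[k] LaurentSeries k) (c : k) (a : F) :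
    ψ (algebraMap k F c * a) = HahnSeries.C c * ψ a := by
  rw [map_mul, AlgHom.commutes, algebraMap_eq_C]

/-- The place of `F` defined by an embedding of `F` in `k((T))`. -/
def Place.ofHom (ψ : F →ₐ[k] LaurentSeries k) (h : ∃ a, ψ a ∉ integers k) : Place k F where
  ring := (integers k).comap (ψ : F →+* LaurentSeries k)
  algebraMap_mem a := by
    rw [ValuationSubring.mem_comap]
    simp only [RingHom.coe_coe, AlgHom.commutes]
    rw [algebraMap_eq_C, mem_integers, HahnSeries.order_C]
  ne_top := by
    obtain ⟨a, ha⟩ := h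
    intro htop
    have : a ∈ (integers k).comap (ψ : F →+* LaurentSeries k) := by rw [htop]; trivial
    exact ha this

theorem Place.mem_ofHom {ψ : F →ₐ[k] LaurentSeries k} {h : ∃ a, ψ a ∉ integers k} {a : F} :
    a ∈ (Place.ofHom ψ h).ring ↔ 0 ≤ (ψ a).order :=
  mem_integers

theorem Place.mem_nonunits_ofHom {ψ : F →ₐ[k] LaurentSeries k} {h : ∃ a, ψ a ∉ integers k} {a : F} :
    a ∈ (Place.ofHom ψ h).ring.nonunits ↔ a = 0 ∨ 1 ≤ (ψ a).order := by
  rw [mem_nonunits_iff_inv, Place.mem_ofHom, map_inv₀, order_inv]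
  refine or_congr_right ?_
  omega

/-- Through `ψ`, `k((T))` is an `F`-module and `b ↦ d(ψ b)/dT` a derivation into it; the universal
property of `Ω` gives `δ`. -/
theorem exists_diffExpand (ψ : F →ₐ[k] LaurentSeries k) :
    ∃ δ : Ω[F⁄k] →ₗ[k] LaurentSeries k,
      (∀ a η, δ (a • η) = ψ a * δ η) ∧ ∀ b, δ (D k F b) = derivative k (ψ b) := by
  let _ : Module F (LaurentSeries k) := Module.compHom _ (ψ : F →+* LaurentSeries k)
  have hsmul : ∀ (a : F) (h : LaurentSeries k), a • h = ψ a * h := fun _ _ => rfl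
  have hk : ∀ (c : k) (h : LaurentSeries k), c • h = HahnSeries.C c * h := fun c h => by
    rw [HahnSeries.C_mul_eq_smul]
  have : IsScalarTower k F (LaurentSeries k) := ⟨fun c a h => by
    rw [hsmul, hsmul, hk, Algebra.smul_def, map_algebraMap_mul, mul_assoc]⟩
  have hlin : ∀ (c : k) (b : F), derivative k (ψ (c • b)) = c • derivative k (ψ b) := fun c b => by
    rw [Algebra.smul_def, map_algebraMap_mul, HahnSeries.C_mul_eq_smul, map_smul]
  let d : Derivation k F (LaurentSeries k) := Derivation.mk'
    { toFun := fun b => derivative k (ψ b)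
      map_add' := fun a b => by rw [map_add, map_add]
      map_smul' := hlin } fun a b => by
        change derivative k (ψ (a * b)) = ψ a * derivative k (ψ b) + ψ b * derivative k (ψ a)
        rw [map_mul, LaurentSeries.derivative_mul]
  refine ⟨d.liftKaehlerDifferential.restrictScalars k, fun a η => ?_, fun b => ?_⟩
  · exact map_smul d.liftKaehlerDifferential a η
  · exact d.liftKaehlerDifferential_comp_D b

/-- The expansion `h` of a differential `h dT`. -/
def diffExpand (ψ : F →ₐ[k] LaurentSeries k) : Ω[F⁄k] →ₗ[k] LaurentSeries k :=
  (exists_diffExpand ψ).choose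

theorem diffExpand_smul (ψ : F →ₐ[k] LaurentSeries k) (a : F) (η : Ω[F⁄k]) :
    diffExpand ψ (a • η) = ψ a * diffExpand ψ η :=
  (exists_diffExpand ψ).choose_spec.1 a η

theorem diffExpand_D (ψ : F →ₐ[k] LaurentSeries k) (b : F) :
    diffExpand ψ (D k F b) = derivative k (ψ b) :=
  (exists_diffExpand ψ).choose_spec.2 b

theorem smul_mem_integers (c : k) {h : LaurentSeries k} (hh : h ∈ integers k) :
    c • h ∈ integers k := by
  rw [← HahnSeries.C_mul_eq_smul]
  exact mul_mem (mem_integers.mpr (by rw [HahnSeries.order_C])) hh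

theorem diffExpand_mem_integers {ψ : F →ₐ[k] LaurentSeries k} {h : ∃ a, ψ a ∉ integers k}
    {η : Ω[F⁄k]} (hη : η ∈ differentialStalk (Place.ofHom ψ h)) :
    diffExpand ψ η ∈ integers k := by
  induction hη using Submodule.span_induction with
  | mem η hη =>
    obtain ⟨a, ha, b, hb, rfl⟩ := hη
    rw [diffExpand_smul, diffExpand_D]
    exact mul_mem ha (derivative_mem_integers hb)
  | zero => rw [map_zero]; exact zero_mem _
  | add a b _ _ ha hb => rw [map_add]; exact add_mem ha hb
  | smul c a _ ha => rw [map_smul]; exact smul_mem_integers c ha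

theorem smul_mem_differentialStalk {P : Place k F} {a : F} (ha : a ∈ P.ring) {η : Ω[F⁄k]}
    (hη : η ∈ differentialStalk P) : a • η ∈ differentialStalk P := by
  induction hη using Submodule.span_induction with
  | mem η hη =>
    obtain ⟨b, hb, c, hc, rfl⟩ := hη
    exact Submodule.subset_span ⟨a * b, mul_mem ha hb, c, hc, by rw [mul_smul]⟩
  | zero => rw [smul_zero]; exact zero_mem _
  | add b c _ _ hb hc => rw [smul_add]; exact add_mem hb hc
  | smul c b _ hb => rw [smul_comm]; exact Submodule.smul_mem _ c hb

theorem smul_D_mem_differentialStalk {P : Place k F} {a b : F} (ha : a ∈ P.ring)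
    (hb : b ∈ P.ring) : a • D k F b ∈ differentialStalk P :=
  Submodule.subset_span ⟨a, ha, b, hb, rfl⟩

theorem neg_le_order_iff (N : ℕ) (h : LaurentSeries k) :
    -(N : ℤ) ≤ h.order ↔ ∀ i < -(N : ℤ), h.coeff i = 0 := by
  constructor
  · intro hN i hi
    exact HahnSeries.coeff_eq_zero_of_lt_order (hi.trans_le hN)
  · intro hc
    by_contra! hlt
    exact (HahnSeries.coeff_order_eq_zero.not.mpr (by rintro rfl; simp at hlt; omega)) (hc _ hlt)

theorem LocalExpansion.mem_ring_iff_order {P : Place k F} (e : LocalExpansion P) (a : F) :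
    a ∈ P.ring ↔ 0 ≤ (e.expand a).order := by
  rw [e.mem_ring_iff, ← mem_range_ofPowerSeries_iff]
  rfl

/-- Any Laurent expansion at a place computes the same residue. -/
theorem HasResidue.eq_coeff {ψ : F →ₐ[k] LaurentSeries k} {h : ∃ a, ψ a ∉ integers k}
    {s : F} (hs : (ψ s).order = 1) {η : Ω[F⁄k]} {c : k}
    (hc : HasResidue (Place.ofHom ψ h) η c) : c = (diffExpand ψ η).coeff (-1) := by
  obtain ⟨e, g, rfl, rfl⟩ := hc
  rw [diffExpand_smul, diffExpand_D]
  have hiff : ∀ a : F, 0 ≤ (ψ a).order ↔ 0 ≤ (e.expand a).order := fun a =>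
    Place.mem_ofHom.symm.trans (e.mem_ring_iff_order a)
  have hT : (e.expand e.t).order = 1 := by
    rw [e.expand_t, HahnSeries.order_single one_ne_zero]
  have ht0 : e.t ≠ 0 := by rintro h0; rw [h0] at hT; simp at hT
  have hs0 : s ≠ 0 := by rintro h0; rw [h0] at hs; simp at hs
  -- Both expansions define the same valuation ring. Since `t⁻¹` is not in it, `ψ t` has order at
  -- least `1`; since `s / t` is in it, the order is at most `1`.
  have hu : (ψ e.t).order = 1 := by
    have h1 := (hiff e.t⁻¹).not.mpr (by rw [map_inv₀, order_inv, hT]; norm_num)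
    have h2 := (hiff s⁻¹).not.mp (by rw [map_inv₀, order_inv, hs]; norm_num)
    have h3 := (hiff (s / e.t)).mpr (by
      rw [map_div₀, order_div (by simpa using hs0) (by simpa using ht0), hT]
      rw [map_inv₀, order_inv] at h2
      omega)
    rw [map_div₀, order_div (by simpa using hs0) (by simpa using ht0), hs] at h3
    rw [map_inv₀, order_inv] at h1
    omega
  -- Induction on the pole order: subtract the leading polar term `b t ^ i`, whose residue is known
  -- in both expansions by `coeff_zpow_mul_derivative`. With no pole left, both sides are `0`.
  have key : ∀ (N : ℕ) (g : F), -(N : ℤ) ≤ (e.expand g).order →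
      (e.expand g).coeff (-1) = (ψ g * derivative k (ψ e.t)).coeff (-1) := by
    intro N
    induction N with
    | zero =>
      intro g hg
      have hg' : 0 ≤ (e.expand g).order := by simpa using hg
      rw [coeff_eq_zero_of_mem_integers (mem_integers.mpr hg') (by norm_num),
        coeff_eq_zero_of_mem_integers (mul_mem (mem_integers.mpr ((hiff g).mpr hg'))
          (derivative_mem_integers (mem_integers.mpr (by rw [hu]; norm_num)))) (by norm_num)]
    | succ N ih =>
      intro g hg
      set i : ℤ := -((N : ℤ) + 1) with hi
      set b := (e.expand g).coeff i
      have hexp : e.expand (algebraMap k F b * e.t ^ i) = HahnSeries.single i b := by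
        rw [map_algebraMap_mul, map_zpow₀, e.expand_t, ← RatFunc.single_zpow]
        simp [HahnSeries.C_apply]
      have h1 := ih (g - algebraMap k F b * e.t ^ i) (by
        rw [neg_le_order_iff] at hg ⊢
        intro j hj
        rw [map_sub, HahnSeries.coeff_sub, hexp]
        rcases eq_or_ne j i with rfl | hji
        · rw [HahnSeries.coeff_single_same]; exact sub_self _
        · rw [HahnSeries.coeff_single_of_ne hji, hg j (by push_cast; omega), sub_zero])
      rw [map_sub, map_sub, sub_mul, HahnSeries.coeff_sub, HahnSeries.coeff_sub, hexp,
        map_algebraMap_mul, map_zpow₀, mul_assoc, HahnSeries.C_mul_eq_smul,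
        HahnSeries.coeff_smul, coeff_zpow_mul_derivative hu (by omega)] at h1
      have h2 : (HahnSeries.single i b).coeff (-1) = b • if i = -1 then (1 : k) else 0 := by
        split_ifs with h
        · rw [h, HahnSeries.coeff_single_same, smul_eq_mul, mul_one]
        · rw [HahnSeries.coeff_single_of_ne (Ne.symm h), smul_zero]
      rw [h2] at h1
      exact sub_left_injective h1
  exact key (e.expand g).order.natAbs g (by omega)

/-- Since `ψ s = T`, `ψ` is itself a local expansion. So a residue exists, and uniqueness fixes the
chosen value. -/
theorem residue_ofHom {ψ : F →ₐ[k] LaurentSeries k} {h : ∃ a, ψ a ∉ integers k}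
    {s : F} (hs : ψ s = HahnSeries.single (1 : ℤ) (1 : k)) (a : F) :
    residue (Place.ofHom ψ h) (a • D k F s) = (diffExpand ψ (a • D k F s)).coeff (-1) := by
  have hex : ∃ c, HasResidue (Place.ofHom ψ h) (a • D k F s) c :=
    ⟨_, ⟨s, ψ, hs, fun _ => Iff.rfl⟩, a, rfl, rfl⟩
  rw [residue, dif_pos hex]
  exact hex.choose_spec.eq_coeff (s := s) (by rw [hs, HahnSeries.order_single one_ne_zero])

end Germs

/-! ### The Kummer extension `F / k(x)` and the action of the `n`-th roots of unity. -/

section FunctionFieldBasics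

variable {k : Type*} [Field k] {r : ℕ} {n : ℕ} {ρ : Fin r → k} {l : Fin r → ℕ}
  [hirr : Fact (Irreducible (equation n ρ l))]

instance isScalarTower_functionField : IsScalarTower k (RatFunc k) (FunctionField n ρ l) :=
  inferInstanceAs (IsScalarTower k (RatFunc k) (AdjoinRoot (equation n ρ l)))

theorem x_eq : x n ρ l = algebraMap (RatFunc k) (FunctionField n ρ l) RatFunc.X := rfl

theorem aeval_x (p : k[X]) : aeval (x n ρ l) p =
    algebraMap (RatFunc k) (FunctionField n ρ l) (algebraMap k[X] (RatFunc k) p) := by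
  rw [x_eq, aeval_algebraMap_apply, RatFunc.aeval_X_left_eq_algebraMap]

theorem aeval_x_ne_zero {p : k[X]} (hp : p ≠ 0) : aeval (x n ρ l) p ≠ 0 := by
  rw [aeval_x]
  simpa using hp

theorem x_ne_zero : x n ρ l ≠ 0 := by
  rw [x_eq]; simp [RatFunc.X_ne_zero]

theorem f_ne_zero : f ρ l ≠ 0 :=
  Finset.prod_ne_zero_iff.mpr fun i _ => pow_ne_zero _ (X_sub_C_ne_zero (ρ i))

theorem y_pow : y n ρ l ^ n = aeval (x n ρ l) (f ρ l) := by
  have h := AdjoinRoot.eval₂_root (equation n ρ l)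
  rw [equation, eval₂_sub, eval₂_X_pow, eval₂_C, sub_eq_zero] at h
  rw [aeval_x]
  exact h

theorem y_ne_zero (hn : n ≠ 0) : y n ρ l ≠ 0 := by
  intro h
  have := y_pow (n := n) (ρ := ρ) (l := l)
  rw [h, zero_pow hn] at this
  exact aeval_x_ne_zero f_ne_zero this.symm

/-- Every function is a combination of `1, y, …, y ^ (n - 1)` over `k(x)`. -/
theorem exists_sum_pow (hn : n ≠ 0) (G : FunctionField n ρ l) :
    ∃ a : ℕ → RatFunc k, G = ∑ j ∈ Finset.range n,
      algebraMap (RatFunc k) (FunctionField n ρ l) (a j) * y n ρ l ^ j := by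
  have hm : (equation n ρ l).Monic := monic_X_pow_sub_C _ hn
  have hd : (equation n ρ l).natDegree = n := natDegree_X_pow_sub_C
  obtain ⟨p, hp⟩ := AdjoinRoot.mk_surjective (g := equation n ρ l) G
  have hp' : AdjoinRoot.mk (equation n ρ l) (p %ₘ equation n ρ l) = G := by
    rw [← hp, AdjoinRoot.mk_eq_mk, modByMonic_eq_sub_mul_div p]
    exact ⟨-(p /ₘ equation n ρ l), by ring⟩
  have hlt : (p %ₘ equation n ρ l).natDegree < n := by
    have := natDegree_modByMonic_lt p hm (by
      intro h
      rw [h, natDegree_one] at hd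
      exact hn hd.symm)
    rwa [hd] at this
  refine ⟨fun j => (p %ₘ equation n ρ l).coeff j, ?_⟩
  conv_lhs => rw [← hp', as_sum_range_C_mul_X_pow' _ hlt]
  rw [map_sum]
  refine Finset.sum_congr rfl fun j _ => ?_
  rw [map_mul, map_pow, AdjoinRoot.mk_X, AdjoinRoot.mk_C]
  rfl

/-- Every function is a combination of `1, y⁻¹, …, y ^ (1 - n)` over `k(x)`. -/
theorem exists_sum_inv_pow (hn : n ≠ 0) (G : FunctionField n ρ l) :
    ∃ a : ℕ → RatFunc k, G = ∑ j ∈ Finset.range n,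
      algebraMap (RatFunc k) (FunctionField n ρ l) (a j) * (y n ρ l)⁻¹ ^ j := by
  obtain ⟨a, ha⟩ := exists_sum_pow hn (G * y n ρ l ^ (n - 1))
  have hy := y_ne_zero (n := n) (ρ := ρ) (l := l) hn
  refine ⟨fun j => a (n - 1 - j), ?_⟩
  rw [← mul_left_inj' (pow_ne_zero (n - 1) hy), ha, ← Finset.sum_range_reflect, Finset.sum_mul]
  refine Finset.sum_congr rfl fun j hj => ?_
  have hj' : j ≤ n - 1 := by have := Finset.mem_range.mp hj; omega
  rw [mul_assoc, inv_pow, pow_sub₀ _ hy hj', mul_comm (y n ρ l ^ (n - 1))]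

theorem aeval_injective {L : Type*} [Field L] [Algebra k L] [IsAlgClosed k] {X₀ : L}
    (hX : X₀ ∉ (algebraMap k L).range) : Function.Injective (aeval (R := k) X₀) := by
  rw [← transcendental_iff_injective]
  intro halg
  apply hX
  have : IsIntegral k X₀ := halg.isIntegral
  have hd := IsAlgClosed.degree_eq_one_of_irreducible k (minpoly.irreducible this)
  exact minpoly.mem_range_of_degree_eq_one k X₀ hd

/-- The homomorphism out of the function field with given values on `x` and `y`. -/
theorem exists_algHom {L : Type*} [Field L] [Algebra k L] [IsAlgClosed k] {X₀ Y₀ : L}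
    (hX : X₀ ∉ (algebraMap k L).range) (hY : Y₀ ^ n = aeval X₀ (f ρ l)) :
    ∃ ψ : FunctionField n ρ l →ₐ[k] L, ψ (x n ρ l) = X₀ ∧ ψ (y n ρ l) = Y₀ := by
  let i : RatFunc k →ₐ[k] L := RatFunc.liftAlgHom (aeval X₀)
    (nonZeroDivisors_le_comap_nonZeroDivisors_of_injective _ (aeval_injective hX))
  have hi : ∀ p : k[X], i (algebraMap k[X] (RatFunc k) p) = aeval X₀ p := fun p => by
    have := RatFunc.liftAlgHom_apply_div (aeval X₀)
      (nonZeroDivisors_le_comap_nonZeroDivisors_of_injective _ (aeval_injective hX)) p 1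
    simpa using this
  have h0 : (equation n ρ l).eval₂ (i : RatFunc k →+* L) Y₀ = 0 := by
    rw [equation, eval₂_sub, eval₂_X_pow, eval₂_C, sub_eq_zero]
    exact hY.trans (hi _).symm
  refine ⟨AdjoinRoot.liftAlgHom (S := k) (equation n ρ l) i Y₀ h0, ?_, ?_⟩
  · refine (AdjoinRoot.lift_of (i := (i : RatFunc k →+* L)) h0).trans ?_
    have := hi X
    rwa [RatFunc.algebraMap_X, aeval_X] at this
  · exact AdjoinRoot.lift_root (i := (i : RatFunc k →+* L)) h0

theorem algHom_aeval_x {L : Type*} [Field L] [Algebra k L] (ψ : FunctionField n ρ l →ₐ[k] L)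
    (p : k[X]) : ψ (aeval (x n ρ l) p) = aeval (ψ (x n ρ l)) p :=
  (aeval_algHom_apply ψ _ p).symm

theorem algebraMap_ratFunc_eq (a : RatFunc k) :
    algebraMap (RatFunc k) (FunctionField n ρ l) a =
      aeval (x n ρ l) a.num / aeval (x n ρ l) a.denom := by
  rw [aeval_x, aeval_x, ← map_div₀, RatFunc.num_div_denom]

theorem algHom_ratFunc_congr {L : Type*} [Field L] [Algebra k L]
    {ψ ψ' : FunctionField n ρ l →ₐ[k] L} (h : ψ (x n ρ l) = ψ' (x n ρ l)) (a : RatFunc k) :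
    ψ (algebraMap (RatFunc k) _ a) = ψ' (algebraMap (RatFunc k) _ a) := by
  rw [algebraMap_ratFunc_eq, map_div₀, map_div₀, algHom_aeval_x, algHom_aeval_x, algHom_aeval_x,
    algHom_aeval_x, h]

theorem x_notMem_range : x n ρ l ∉ (algebraMap k (FunctionField n ρ l)).range := by
  rintro ⟨c, hc⟩
  have h : aeval (x n ρ l) (X - C c) = 0 := by
    rw [map_sub, aeval_X, aeval_C, hc, sub_self]
  exact aeval_x_ne_zero (X_sub_C_ne_zero c) h

/-- The automorphism `y ↦ ζ y` of the function field. -/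
theorem exists_twist [IsAlgClosed k] {ζ : k} (hζ : ζ ^ n = 1) :
    ∃ σ : FunctionField n ρ l →ₐ[k] FunctionField n ρ l,
      σ (x n ρ l) = x n ρ l ∧ σ (y n ρ l) = algebraMap k _ ζ * y n ρ l :=
  exists_algHom x_notMem_range (by rw [mul_pow, ← map_pow, hζ, map_one, one_mul, y_pow])

open Classical in
/-- The automorphism `y ↦ ζ y` of the function field, for an `n`-th root of unity `ζ`. -/
def twist [IsAlgClosed k] (n : ℕ) (ρ : Fin r → k) (l : Fin r → ℕ)
    [Fact (Irreducible (equation n ρ l))] (ζ : k) :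
    FunctionField n ρ l →ₐ[k] FunctionField n ρ l :=
  if h : ζ ^ n = 1 then (exists_twist h).choose else AlgHom.id k _

theorem twist_x [IsAlgClosed k] {ζ : k} : twist n ρ l ζ (x n ρ l) = x n ρ l := by
  rw [twist]
  split_ifs with h
  · exact (exists_twist h).choose_spec.1
  · rfl

theorem twist_y [IsAlgClosed k] {ζ : k} (hζ : ζ ^ n = 1) :
    twist n ρ l ζ (y n ρ l) = algebraMap k _ ζ * y n ρ l := by
  rw [twist, dif_pos hζ]
  exact (exists_twist hζ).choose_spec.2

theorem twist_ratFunc [IsAlgClosed k] {ζ : k} (a : RatFunc k) :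
    twist n ρ l ζ (algebraMap (RatFunc k) _ a) = algebraMap (RatFunc k) _ a :=
  algHom_ratFunc_congr (ψ := twist n ρ l ζ) (ψ' := AlgHom.id k _) twist_x a

/-- Multiplication by a primitive root `z` permutes the roots of unity, so the sum is fixed by the
factor `z ^ j`, which is `1` only when `n ∣ j`. -/
theorem sum_rootsOfUnity_zpow [IsAlgClosed k] (hn : (n : k) ≠ 0) (j : ℤ) :
    ∑ ζ ∈ nthRootsFinset n (1 : k), ζ ^ j = if (n : ℤ) ∣ j then (n : k) else 0 := by
  have hn0 : 0 < n := Nat.pos_of_ne_zero (by rintro rfl; simp at hn)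
  have : NeZero (n : k) := ⟨hn⟩
  obtain ⟨z, hz⟩ := HasEnoughRootsOfUnity.exists_primitiveRoot k n
  have hcard : (nthRootsFinset n (1 : k)).card = n := hz.card_nthRootsFinset
  have hmem : ∀ ζ : k, ζ ∈ nthRootsFinset n (1 : k) ↔ ζ ^ n = 1 := fun ζ =>
    Polynomial.mem_nthRootsFinset hn0 1
  split_ifs with h
  · obtain ⟨i, rfl⟩ := h
    rw [Finset.sum_congr rfl (g := fun _ => (1 : k)) fun ζ hζ => by
      rw [zpow_mul, zpow_natCast, (hmem ζ).mp hζ, one_zpow]]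
    rw [Finset.sum_const, hcard, nsmul_one]
  · have hz0 : z ≠ 0 := hz.ne_zero hn0.ne'
    have hne : z ^ j ≠ 1 := fun h1 => h ((hz.zpow_eq_one_iff_dvd j).mp h1)
    have hS : z ^ j * ∑ ζ ∈ nthRootsFinset n (1 : k), ζ ^ j =
        ∑ ζ ∈ nthRootsFinset n (1 : k), ζ ^ j := by
      rw [Finset.mul_sum]
      refine Finset.sum_bij' (fun ζ _ => z * ζ) (fun ζ _ => z⁻¹ * ζ) ?_ ?_ ?_ ?_ ?_
      · intro ζ hζ
        rw [hmem] at hζ ⊢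
        rw [mul_pow, hζ, hz.pow_eq_one, one_mul]
      · intro ζ hζ
        rw [hmem] at hζ ⊢
        rw [mul_pow, hζ, inv_pow, hz.pow_eq_one, inv_one, one_mul]
      · intro ζ _; field_simp
      · intro ζ _; field_simp
      · intro ζ _; rw [mul_zpow]
    have : (z ^ j - 1) * ∑ ζ ∈ nthRootsFinset n (1 : k), ζ ^ j = 0 := by
      rw [sub_mul, hS, one_mul, sub_self]
    exact (mul_eq_zero.mp this).resolve_left (sub_ne_zero.mpr hne)

end FunctionFieldBasics

/-! ### Expansions above finite points. -/

section LocalGerms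

open LaurentSeries

variable {k : Type*} [Field k] {r : ℕ} {n : ℕ} {ρ : Fin r → k} {l : Fin r → ℕ}

theorem aeval_ofPowerSeries (s : PowerSeries k) (q : k[X]) :
    aeval (HahnSeries.ofPowerSeries ℤ k s) q = HahnSeries.ofPowerSeries ℤ k (aeval s q) := by
  rw [aeval_def, aeval_def, hom_eval₂]
  congr 1

theorem constantCoeff_aeval (s : PowerSeries k) (q : k[X]) :
    PowerSeries.constantCoeff (aeval s q) = q.eval (PowerSeries.constantCoeff s) := by
  have h : PowerSeries.constantCoeff.comp (algebraMap k (PowerSeries k)) = RingHom.id k := by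
    ext c
    exact PowerSeries.constantCoeff_C c
  rw [aeval_def, hom_eval₂, h]
  rfl

/-- The ramification index of the curve above `c`. -/
def eAt (n : ℕ) (ρ : Fin r → k) (l : Fin r → ℕ) (c : k) : ℕ :=
  n / Nat.gcd n ((f ρ l).rootMultiplicity c)

/-- The order of `y` at the points above `c`. -/
def lamAt (n : ℕ) (ρ : Fin r → k) (l : Fin r → ℕ) (c : k) : ℕ :=
  (f ρ l).rootMultiplicity c / Nat.gcd n ((f ρ l).rootMultiplicity c)

theorem eAt_mul_gcd (c : k) :
    eAt n ρ l c * Nat.gcd n ((f ρ l).rootMultiplicity c) = n :=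
  Nat.div_mul_cancel (Nat.gcd_dvd_left _ _)

theorem lamAt_mul_gcd (c : k) :
    lamAt n ρ l c * Nat.gcd n ((f ρ l).rootMultiplicity c) = (f ρ l).rootMultiplicity c :=
  Nat.div_mul_cancel (Nat.gcd_dvd_right _ _)

theorem eAt_mul_rootMultiplicity (c : k) :
    eAt n ρ l c * (f ρ l).rootMultiplicity c = lamAt n ρ l c * n := by
  have h1 := eAt_mul_gcd (n := n) (ρ := ρ) (l := l) c
  have h2 := lamAt_mul_gcd (n := n) (ρ := ρ) (l := l) c
  calc _ = eAt n ρ l c * (lamAt n ρ l c * Nat.gcd n ((f ρ l).rootMultiplicity c)) := by rw [h2]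
    _ = lamAt n ρ l c * (eAt n ρ l c * Nat.gcd n ((f ρ l).rootMultiplicity c)) := by ring
    _ = _ := by rw [h1]

theorem eAt_ne_zero (hn : (n : k) ≠ 0) (c : k) : (eAt n ρ l c : k) ≠ 0 := by
  intro h
  apply hn
  rw [← eAt_mul_gcd (n := n) (ρ := ρ) (l := l) c, Nat.cast_mul, h, zero_mul]

theorem eAt_pos (hn : (n : k) ≠ 0) (c : k) : 0 < eAt n ρ l c :=
  Nat.pos_of_ne_zero fun h => eAt_ne_zero (ρ := ρ) (l := l) hn c (by rw [h, Nat.cast_zero])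

variable [hirr : Fact (Irreducible (equation n ρ l))]

/-- `ψ` is an expansion at a point above `x = c`, in a parameter `T` with `x = c + T ^ e`. -/
structure FiniteGerm (c : k) (ψ : FunctionField n ρ l →ₐ[k] LaurentSeries k) : Prop where
  map_x : ψ (x n ρ l) = HahnSeries.C c + HahnSeries.single (eAt n ρ l c : ℤ) 1
  order_y : (ψ (y n ρ l)).order = lamAt n ρ l c

theorem C_add_single_eq (c : k) (e : ℕ) :
    HahnSeries.C c + HahnSeries.single (e : ℤ) 1 =
      HahnSeries.ofPowerSeries ℤ k (PowerSeries.C c + PowerSeries.X ^ e) := by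
  rw [map_add, HahnSeries.ofPowerSeries_C, HahnSeries.ofPowerSeries_X_pow]

/-- Write `q = (X - c) ^ m q₁` with `q₁(c) ≠ 0`: the first factor becomes `T ^ (e m)` and the second
a unit of `k⟦T⟧`. -/
theorem order_aeval_C_add_single (c : k) {e : ℕ} (he : 0 < e) {q : k[X]} (hq : q ≠ 0) :
    aeval (HahnSeries.C c + HahnSeries.single (e : ℤ) 1 : LaurentSeries k) q ≠ 0 ∧
    (aeval (HahnSeries.C c + HahnSeries.single (e : ℤ) 1 : LaurentSeries k) q).order =
      e * q.rootMultiplicity c := by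
  set X₀ : LaurentSeries k := HahnSeries.C c + HahnSeries.single (e : ℤ) 1 with hX₀
  obtain ⟨q₁, hq₁, hnd⟩ := exists_eq_pow_rootMultiplicity_mul_and_not_dvd q hq c
  have h1 : aeval X₀ q = (HahnSeries.single (e : ℤ) 1) ^ q.rootMultiplicity c * aeval X₀ q₁ := by
    conv_lhs => rw [hq₁]
    rw [map_mul, map_pow, map_sub, aeval_X, aeval_C, algebraMap_eq_C, hX₀, add_sub_cancel_left]
  have h2 : aeval X₀ q₁ = HahnSeries.ofPowerSeries ℤ k
      (aeval (PowerSeries.C c + PowerSeries.X ^ e) q₁) := by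
    rw [hX₀, C_add_single_eq, aeval_ofPowerSeries]
  have h3 : PowerSeries.constantCoeff (aeval (PowerSeries.C c + PowerSeries.X ^ e) q₁) ≠ 0 := by
    rw [constantCoeff_aeval]
    simpa [he.ne', dvd_iff_isRoot] using hnd
  have h4 : aeval X₀ q₁ ≠ 0 := by
    rw [h2]
    intro h
    rw [← map_zero (HahnSeries.ofPowerSeries ℤ k)] at h
    rw [HahnSeries.ofPowerSeries_injective h, map_zero] at h3
    exact h3 rfl
  have h5 : (HahnSeries.single (e : ℤ) (1 : k)) ^ q.rootMultiplicity c ≠ 0 :=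
    pow_ne_zero _ (by simp)
  refine ⟨by rw [h1]; exact mul_ne_zero h5 h4, ?_⟩
  rw [h1, HahnSeries.order_mul h5 h4, HahnSeries.order_pow, HahnSeries.order_single one_ne_zero,
    h2, ofPowerSeries_order _ h3, add_zero, nsmul_eq_mul, mul_comm]

theorem order_ne_notMem_range {h : LaurentSeries k} (hh : h.order ≠ 0) :
    h ∉ (algebraMap k (LaurentSeries k)).range := by
  rintro ⟨c, rfl⟩
  rw [algebraMap_eq_C, HahnSeries.order_C] at hh
  exact hh rfl

/-- With `f = (X - c) ^ m f₁`, the value of `f` at `c + T ^ e` is `T ^ (e m)` times a unit. As `e m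
= λ n`, the power is `(T ^ λ) ^ n`, and the unit has an `n`-th root by Hensel. -/
theorem exists_finiteGerm [IsAlgClosed k] (hn : (n : k) ≠ 0) (c : k) :
    ∃ ψ : FunctionField n ρ l →ₐ[k] LaurentSeries k, FiniteGerm c ψ := by
  have hn0 : 0 < n := Nat.pos_of_ne_zero (by rintro rfl; simp at hn)
  have he := eAt_pos (ρ := ρ) (l := l) hn c
  set X₀ : LaurentSeries k := HahnSeries.C c + HahnSeries.single (eAt n ρ l c : ℤ) 1 with hX₀
  obtain ⟨q₁, hq₁, hnd⟩ := exists_eq_pow_rootMultiplicity_mul_and_not_dvd (f ρ l) f_ne_zero c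
  have hb0 : q₁.eval c ≠ 0 := by simpa [dvd_iff_isRoot] using hnd
  obtain ⟨b, hb⟩ := IsAlgClosed.exists_pow_nat_eq (q₁.eval c) hn0
  have hbne : b ≠ 0 := by rintro rfl; rw [zero_pow hn0.ne'] at hb; exact hb0 hb.symm
  obtain ⟨w, hw0, hw⟩ := PowerSeries.exists_pow_eq n hn
    (aeval (PowerSeries.C c + PowerSeries.X ^ eAt n ρ l c) q₁) b hbne (by
      rw [constantCoeff_aeval, hb]; simp [he.ne'])
  have hword : (HahnSeries.ofPowerSeries ℤ k w).order = 0 :=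
    ofPowerSeries_order w (by rw [hw0]; exact hbne)
  have hwne : HahnSeries.ofPowerSeries ℤ k w ≠ 0 := by
    intro h
    rw [← map_zero (HahnSeries.ofPowerSeries ℤ k)] at h
    rw [HahnSeries.ofPowerSeries_injective h, map_zero] at hw0
    exact hbne hw0.symm
  obtain ⟨ψ, h1, h2⟩ := exists_algHom (n := n) (ρ := ρ) (l := l) (X₀ := X₀)
    (Y₀ := HahnSeries.single (lamAt n ρ l c : ℤ) 1 * HahnSeries.ofPowerSeries ℤ k w) (by
      intro h
      have h3 : HahnSeries.single (eAt n ρ l c : ℤ) (1 : k) ∈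
          (algebraMap k (LaurentSeries k)).range := by
        have := sub_mem h ⟨c, algebraMap_eq_C c⟩
        rwa [hX₀, add_sub_cancel_left] at this
      exact order_ne_notMem_range (by rw [HahnSeries.order_single one_ne_zero]; omega) h3) (by
      conv_rhs => rw [hq₁]
      rw [map_mul, map_pow, map_sub, aeval_X, aeval_C, algebraMap_eq_C, hX₀, add_sub_cancel_left,
        C_add_single_eq, aeval_ofPowerSeries, ← hw, mul_pow, map_pow, HahnSeries.single_pow,
        HahnSeries.single_pow, one_pow, one_pow]
      have h4 : n • (lamAt n ρ l c : ℤ) = (f ρ l).rootMultiplicity c • (eAt n ρ l c : ℤ) := by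
        have := eAt_mul_rootMultiplicity (n := n) (ρ := ρ) (l := l) c
        rw [nsmul_eq_mul, nsmul_eq_mul, mul_comm, mul_comm ((f ρ l).rootMultiplicity c : ℤ)]
        exact_mod_cast this.symm
      rw [h4])
  refine ⟨ψ, h1, ?_⟩
  rw [h2, HahnSeries.order_mul (by simp) hwne, HahnSeries.order_single one_ne_zero, hword, add_zero]

theorem twist_order_y [IsAlgClosed k] (ψ : FunctionField n ρ l →ₐ[k] LaurentSeries k)
    (hn : n ≠ 0) {ζ : k} (hζ : ζ ^ n = 1) :
    (ψ.comp (twist n ρ l ζ) (y n ρ l)).order = (ψ (y n ρ l)).order := by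
  have hζ0 : ζ ≠ 0 := by rintro rfl; rw [zero_pow hn] at hζ; exact zero_ne_one hζ
  rw [AlgHom.comp_apply, twist_y hζ, map_algebraMap_mul,
    HahnSeries.order_mul (by simpa using hζ0) (by simpa using y_ne_zero hn), HahnSeries.order_C,
    zero_add]

namespace FiniteGerm

variable {c : k} {ψ : FunctionField n ρ l →ₐ[k] LaurentSeries k}

theorem order_aeval (h : FiniteGerm c ψ) (hn : (n : k) ≠ 0) {q : k[X]} (hq : q ≠ 0) :
    (ψ (aeval (x n ρ l) q)).order = eAt n ρ l c * q.rootMultiplicity c := by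
  rw [algHom_aeval_x, h.map_x, (order_aeval_C_add_single c (eAt_pos hn c) hq).2]

theorem twist [IsAlgClosed k] (h : FiniteGerm c ψ) (hn : n ≠ 0) {ζ : k} (hζ : ζ ^ n = 1) :
    FiniteGerm c (ψ.comp (twist n ρ l ζ)) where
  map_x := by rw [AlgHom.comp_apply, twist_x, h.map_x]
  order_y := by rw [twist_order_y ψ hn hζ, h.order_y]

theorem map_x_sub (h : FiniteGerm c ψ) :
    ψ (x n ρ l - algebraMap k _ c) = HahnSeries.single (eAt n ρ l c : ℤ) 1 := by
  rw [map_sub, h.map_x, AlgHom.commutes, algebraMap_eq_C, add_sub_cancel_left]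

theorem notMem_integers (h : FiniteGerm c ψ) (hn : (n : k) ≠ 0) :
    ∃ a, ψ a ∉ integers k := by
  refine ⟨(x n ρ l - algebraMap k _ c)⁻¹, ?_⟩
  have := eAt_pos (ρ := ρ) (l := l) hn c
  rw [mem_integers, map_inv₀, h.map_x_sub, order_inv, HahnSeries.order_single one_ne_zero]
  omega

theorem mem_fiber (h : FiniteGerm c ψ) (hn : (n : k) ≠ 0) :
    Place.ofHom ψ (h.notMem_integers hn) ∈ fiber (x n ρ l) (c : OnePoint k) := by
  change x n ρ l - algebraMap k _ c ∈ (Place.ofHom ψ (h.notMem_integers hn)).ring.nonunits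
  rw [Place.mem_nonunits_ofHom, h.map_x_sub, HahnSeries.order_single one_ne_zero]
  have := eAt_pos (ρ := ρ) (l := l) hn c
  omega

theorem diffExpand_D_x (h : FiniteGerm c ψ) :
    diffExpand ψ (D k _ (x n ρ l)) =
      HahnSeries.single ((eAt n ρ l c : ℤ) - 1) (eAt n ρ l c : k) := by
  rw [diffExpand_D, h.map_x, map_add, HahnSeries.C_apply, derivative_single, derivative_single]
  simp

/-- A rational function of `x` whose order above `c` exceeds `-e` has no pole at `c`. -/
theorem denom_eval_ne_zero (h : FiniteGerm c ψ) (hn : (n : k) ≠ 0) {b : RatFunc k}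
    (hb : b ≠ 0 → -(eAt n ρ l c : ℤ) < (ψ (algebraMap (RatFunc k) _ b)).order) :
    b.denom.eval c ≠ 0 := by
  rcases eq_or_ne b 0 with rfl | hb0
  · simp
  intro hd
  have hnum : b.num.eval c ≠ 0 := fun hN => by
    obtain ⟨u, v, huv⟩ := RatFunc.isCoprime_num_denom b
    have := congrArg (eval c) huv
    simp [hN, hd] at this
  have h1 := hb hb0
  have hN0 : b.num ≠ 0 := RatFunc.num_ne_zero hb0
  have hD0 : b.denom ≠ 0 := RatFunc.denom_ne_zero b
  rw [algebraMap_ratFunc_eq, map_div₀, order_div (by simpa using aeval_x_ne_zero hN0)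
    (by simpa using aeval_x_ne_zero hD0), h.order_aeval hn hN0, h.order_aeval hn hD0,
    rootMultiplicity_eq_zero hnum] at h1
  have h2 : 1 ≤ b.denom.rootMultiplicity c := (rootMultiplicity_pos hD0).mpr hd
  -- Orders of elements of `k(x)` are multiples of `e`, so a pole at `c` already costs order `-e`.
  have : (eAt n ρ l c : ℤ) * 1 ≤ eAt n ρ l c * b.denom.rootMultiplicity c := by
    gcongr
    exact_mod_cast h2
  simp at h1
  omega

end FiniteGerm

end LocalGerms

/-! ### Orders of `g_μ`, the degree identity, and componentwise regularity above finite points. -/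

section PlaneModel

open LaurentSeries

variable {k : Type*} [Field k] {r : ℕ} {n : ℕ} {ρ : Fin r → k} {l : Fin r → ℕ}

theorem prod_pow_ne_zero (a : Fin r → ℕ) : ∏ i, (X - C (ρ i)) ^ a i ≠ 0 :=
  Finset.prod_ne_zero_iff.mpr fun i _ => pow_ne_zero _ (X_sub_C_ne_zero (ρ i))

theorem rootMultiplicity_prod_pow (a : Fin r → ℕ) (c : k) [DecidableEq k] :
    (∏ i, (X - C (ρ i)) ^ a i).rootMultiplicity c = ∑ i, if c = ρ i then a i else 0 := by
  rw [← count_roots, roots_prod _ _ (prod_pow_ne_zero a), Multiset.count_bind]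
  change ∑ i, _ = _
  refine Finset.sum_congr rfl fun i _ => ?_
  rw [roots_pow, roots_X_sub_C, Multiset.nsmul_singleton, Multiset.count_replicate]
  simp only [eq_comm]

theorem natDegree_prod_pow (a : Fin r → ℕ) :
    (∏ i, (X - C (ρ i)) ^ a i).natDegree = ∑ i, a i := by
  rw [natDegree_prod_of_monic _ _ fun i _ => (monic_X_sub_C (ρ i)).pow _]
  simp [natDegree_pow]

theorem monic_prod_pow (a : Fin r → ℕ) : (∏ i, (X - C (ρ i)) ^ a i).Monic :=
  monic_prod_of_monic _ _ fun i _ => (monic_X_sub_C (ρ i)).pow _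

theorem g_ne_zero (μ : ℕ) : g n ρ l μ ≠ 0 := prod_pow_ne_zero _

theorem natDegree_f : (f ρ l).natDegree = ∑ i, l i := natDegree_prod_pow l

theorem natDegree_g (μ : ℕ) : (g n ρ l μ).natDegree = ∑ i, m n l μ i := natDegree_prod_pow _

/-- At `c = ρ i` the two sides agree by definition; at any other `c` they vanish. This lets branch
points and ordinary points be treated together. -/
theorem rootMultiplicity_g (hρ : Function.Injective ρ) (μ : ℕ) (c : k) :
    (g n ρ l μ).rootMultiplicity c = μ * lamAt n ρ l c / eAt n ρ l c := by
  classical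
  rw [lamAt, eAt, f, g, rootMultiplicity_prod_pow, rootMultiplicity_prod_pow]
  by_cases h : ∃ i, c = ρ i
  · obtain ⟨i, rfl⟩ := h
    simp only [hρ.eq_iff, Finset.sum_ite_eq, Finset.mem_univ, if_true]
    rfl
  · push Not at h
    simp [h]

/-- Multiply `μ λ_i = m_i e_i + υ_i` by `g_i` and sum. The result also shows that the division in
`t` is exact. As `y` has a pole of order `(∑ l i) / n` at `∞`, `t^{(μ)}` is the pole order of `y ^ μ
/ g_μ` there. -/
theorem degree_identity (hn : n ≠ 0) (hdeg : n ∣ ∑ i, l i) (μ : ℕ) :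
    μ * ((∑ i, l i) / n) = (∑ i, m n l μ i) + t n l μ := by
  have h1 : ∀ i, μ * l i = n * m n l μ i + gNum n l i * upsilon n l μ i := fun i => by
    have hg : lam n l i * gNum n l i = l i := Nat.div_mul_cancel (Nat.gcd_dvd_right _ _)
    have he : e n l i * gNum n l i = n := Nat.div_mul_cancel (Nat.gcd_dvd_left _ _)
    have hm := Nat.div_add_mod (μ * lam n l i) (e n l i)
    calc μ * l i = (μ * lam n l i) * gNum n l i := by rw [mul_assoc, hg]
      _ = (e n l i * gNum n l i) * (μ * lam n l i / e n l i) +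
          gNum n l i * (μ * lam n l i % e n l i) := by
        conv_lhs => rw [← hm]
        ring
      _ = _ := by rw [he]; rfl
  obtain ⟨L, hL⟩ := hdeg
  have h2 : n * (μ * L) = n * (∑ i, m n l μ i) + ∑ i, gNum n l i * upsilon n l μ i := by
    rw [Finset.mul_sum, ← Finset.sum_add_distrib, ← Finset.sum_congr rfl fun i _ => h1 i,
      ← Finset.mul_sum, hL]
    ring
  have h3 : n ∣ ∑ i, gNum n l i * upsilon n l μ i :=
    (Nat.dvd_add_right (dvd_mul_right n _)).mp (h2 ▸ dvd_mul_right n _)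
  obtain ⟨s, hs⟩ := h3
  have hn' := Nat.pos_of_ne_zero hn
  rw [hL, t, hs, Nat.mul_div_cancel_left _ hn', Nat.mul_div_cancel_left _ hn']
  rw [hs, ← mul_add] at h2
  exact Nat.eq_of_mul_eq_mul_left hn' h2

theorem t_zero : t n l 0 = 0 := by simp [t, upsilon]

theorem g_zero : g n ρ l 0 = 1 := by simp [g, m]

section Places

variable {F : Type*} [Field F] [Algebra k F]

theorem mem_of_pow_mem {F : Type*} [Field F] (A : ValuationSubring F) {a : F} {N : ℕ} (hN : N ≠ 0)
    (h : a ^ N ∈ A) : a ∈ A := by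
  rw [← A.valuation_le_one_iff, map_pow] at h
  rw [← A.valuation_le_one_iff]
  exact (pow_le_one_iff hN).mp h

theorem add_mem_nonunits {F : Type*} [Field F] {A : ValuationSubring F} {a b : F}
    (ha : a ∈ A.nonunits) (hb : b ∈ A.nonunits) : a + b ∈ A.nonunits := by
  rw [ValuationSubring.mem_nonunits_iff] at *
  exact Valuation.map_add_lt _ ha hb

theorem mul_mem_nonunits {F : Type*} [Field F] {A : ValuationSubring F} {a b : F}
    (ha : a ∈ A.nonunits) (hb : b ∈ A) : a * b ∈ A.nonunits := by
  rw [ValuationSubring.mem_nonunits_iff] at *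
  rw [← A.valuation_le_one_iff] at hb
  rw [map_mul]
  exact mul_lt_one_of_nonneg_of_lt_one_left zero_le ha hb

theorem mem_of_mem_nonunits {F : Type*} [Field F] {A : ValuationSubring F} {a : F}
    (ha : a ∈ A.nonunits) : a ∈ A := by
  rw [← A.valuation_le_one_iff]
  exact ((ValuationSubring.mem_nonunits_iff _).mp ha).le

theorem Place.algebraMap_notMem_nonunits (P : Place k F) {c : k} (hc : c ≠ 0) :
    algebraMap k F c ∉ P.ring.nonunits := by
  rw [mem_nonunits_iff_inv, ← map_inv₀]
  push Not
  exact ⟨by simpa using hc, P.algebraMap_mem _⟩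

theorem Place.aeval_mem (P : Place k F) {z : F} (hz : z ∈ P.ring) (q : k[X]) :
    aeval z q ∈ P.ring := by
  rw [aeval_eq_sum_range]
  refine sum_mem fun i _ => ?_
  rw [Algebra.smul_def]
  exact mul_mem (P.algebraMap_mem _) (pow_mem hz _)

/-- Modulo the maximal ideal, `q(z)` equals the nonzero constant `q(c)`. -/
theorem Place.inv_aeval_mem (P : Place k F) {z : F} {c : k}
    (hz : z - algebraMap k F c ∈ P.ring.nonunits) {q : k[X]} (hq : q.eval c ≠ 0) :
    (aeval z q)⁻¹ ∈ P.ring := by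
  have hzmem : z ∈ P.ring := by
    have := add_mem (mem_of_mem_nonunits hz) (P.algebraMap_mem c)
    rwa [sub_add_cancel] at this
  by_contra hinv
  have h1 : aeval z q ∈ P.ring.nonunits := (mem_nonunits_iff_inv _ _).mpr (Or.inr hinv)
  obtain ⟨q₁, hq₁⟩ := X_sub_C_dvd_sub_C_eval (a := c) (p := q)
  have h2 : algebraMap k F (q.eval c) =
      aeval z q + (z - algebraMap k F c) * (-aeval z q₁) := by
    have := congrArg (aeval z) hq₁
    rw [map_sub, map_mul, map_sub, aeval_C, aeval_C, aeval_X] at this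
    linear_combination -this
  refine P.algebraMap_notMem_nonunits hq ?_
  rw [h2]
  exact add_mem_nonunits h1 (mul_mem_nonunits hz (neg_mem (P.aeval_mem hzmem _)))

end Places

variable [hirr : Fact (Irreducible (equation n ρ l))]

/-- Every place lies above a point of the projective line. -/
theorem exists_mem_fiber [IsAlgClosed k] (hn : n ≠ 0) (P : Place k (FunctionField n ρ l)) :
    ∃ a : OnePoint k, P ∈ fiber (x n ρ l) a := by
  -- Otherwise the ring of `P` contains `x`, the inverses of all nonzero polynomials in `x`, and `y`
  -- (because `y ^ n` is in it), hence all of `F`.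
  by_contra! hno
  have hx : x n ρ l ∈ P.ring := by
    have := hno OnePoint.infty
    change ¬ (x n ρ l ∉ P.ring) at this
    exact not_not.mp this
  have hinv : ∀ q : k[X], q ≠ 0 → (aeval (x n ρ l) q)⁻¹ ∈ P.ring := by
    intro q hq
    induction hd : q.natDegree generalizing q with
    | zero =>
      rw [eq_C_of_natDegree_eq_zero hd, aeval_C, ← map_inv₀]
      exact P.algebraMap_mem _
    | succ d ih =>
      obtain ⟨c, hc⟩ := IsAlgClosed.exists_root q (by
        rw [degree_eq_natDegree hq, hd]; norm_cast)
      obtain ⟨q₁, rfl⟩ := dvd_iff_isRoot.mpr hc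
      have hq₁ : q₁ ≠ 0 := right_ne_zero_of_mul hq
      rw [natDegree_mul (X_sub_C_ne_zero c) hq₁, natDegree_X_sub_C] at hd
      rw [map_mul, mul_inv]
      refine mul_mem ?_ (ih q₁ hq₁ (by omega))
      have := hno (c : OnePoint k)
      change ¬ (x n ρ l - algebraMap k _ c ∈ P.ring.nonunits) at this
      rw [mem_nonunits_iff_inv] at this
      push Not at this
      rw [map_sub, aeval_X, aeval_C]
      exact this.2
  have hy : y n ρ l ∈ P.ring := mem_of_pow_mem _ hn (by rw [y_pow]; exact P.aeval_mem hx _)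
  apply P.ne_top
  rw [eq_top_iff]
  intro G _
  obtain ⟨a, rfl⟩ := exists_sum_pow hn G
  refine sum_mem fun j _ => mul_mem ?_ (pow_mem hy _)
  rw [algebraMap_ratFunc_eq, div_eq_mul_inv]
  exact mul_mem (P.aeval_mem hx _) (hinv _ (RatFunc.denom_ne_zero _))

/-- Weighting the conjugates by `ζ ^ (-ε i)` and summing over `ζ` gives `n` times the `i`-th term,
and `n` is invertible in `k`. Functions use `ε = 1`, `h = 1`; differentials use `ε = -1` and the
expansion of `dx` as `h`. -/
theorem mem_integers_component [IsAlgClosed k] (hn : (n : k) ≠ 0)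
    (ψ : FunctionField n ρ l →ₐ[k] LaurentSeries k) (h : LaurentSeries k)
    {ε : ℤ} (hε : ε = 1 ∨ ε = -1) (a : ℕ → RatFunc k)
    (hint : ∀ ζ : k, ζ ^ n = 1 → ψ (twist n ρ l ζ (∑ j ∈ Finset.range n,
      algebraMap (RatFunc k) _ (a j) * y n ρ l ^ (ε * j))) * h ∈ integers k)
    {i : ℕ} (hi : i < n) :
    ψ (algebraMap (RatFunc k) _ (a i) * y n ρ l ^ (ε * i)) * h ∈ integers k := by
  have hn0 : 0 < n := by omega
  set b : ℕ → LaurentSeries k := fun j =>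
    ψ (algebraMap (RatFunc k) _ (a j) * y n ρ l ^ (ε * j)) * h with hb
  have hmem : ∀ ζ : k, ζ ∈ nthRootsFinset n (1 : k) ↔ ζ ^ n = 1 := fun ζ =>
    Polynomial.mem_nthRootsFinset hn0 1
  have h1 : ∀ ζ ∈ nthRootsFinset n (1 : k), ψ (twist n ρ l ζ (∑ j ∈ Finset.range n,
      algebraMap (RatFunc k) _ (a j) * y n ρ l ^ (ε * j))) * h =
      ∑ j ∈ Finset.range n, HahnSeries.C (ζ ^ (ε * j)) * b j := by
    intro ζ hζ
    rw [map_sum, map_sum, Finset.sum_mul]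
    refine Finset.sum_congr rfl fun j _ => ?_
    rw [map_mul, twist_ratFunc, map_zpow₀, twist_y ((hmem ζ).mp hζ), mul_zpow, ← map_zpow₀,
      mul_left_comm, map_algebraMap_mul, mul_assoc]
  have h2 : ∑ ζ ∈ nthRootsFinset n (1 : k), HahnSeries.C (ζ ^ (-(ε * i))) *
      ∑ j ∈ Finset.range n, HahnSeries.C (ζ ^ (ε * j)) * b j = HahnSeries.C (n : k) * b i := by
    simp_rw [Finset.mul_sum]
    rw [Finset.sum_comm]
    rw [Finset.sum_eq_single_of_mem i (Finset.mem_range.mpr hi)]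
    · rw [Finset.sum_congr rfl (g := fun ζ => HahnSeries.C (ζ ^ (0 : ℤ)) * b i) fun ζ hζ => by
        have hζ0 : ζ ≠ 0 := by
          rintro rfl
          have := (hmem 0).mp hζ
          rw [zero_pow hn0.ne'] at this
          exact zero_ne_one this
        rw [← mul_assoc, ← map_mul, ← zpow_add₀ hζ0, neg_add_cancel]]
      rw [← Finset.sum_mul, ← map_sum, sum_rootsOfUnity_zpow hn, if_pos (dvd_zero _)]
    · intro j hj hji
      rw [Finset.sum_congr rfl (g := fun ζ => HahnSeries.C (ζ ^ (ε * (j - i))) * b j)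
        fun ζ hζ => by
          have hζ0 : ζ ≠ 0 := by
            rintro rfl
            have := (hmem 0).mp hζ
            rw [zero_pow hn0.ne'] at this
            exact zero_ne_one this
          rw [← mul_assoc, ← map_mul, ← zpow_add₀ hζ0]
          congr 3
          ring]
      rw [← Finset.sum_mul, ← map_sum, sum_rootsOfUnity_zpow hn, if_neg, map_zero, zero_mul]
      intro hd
      have hd' : (n : ℤ) ∣ j - i := by
        rcases hε with rfl | rfl
        · simpa using hd
        · rw [neg_one_mul, Int.dvd_neg] at hd; exact hd
      have hj' := Finset.mem_range.mp hj
      have := Int.eq_zero_of_abs_lt_dvd hd' (by rw [abs_lt]; omega)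
      omega
  have h3 : HahnSeries.C (n : k) * b i ∈ integers k := by
    rw [← h2]
    refine sum_mem fun ζ hζ => mul_mem (mem_integers.mpr (by rw [HahnSeries.order_C])) ?_
    rw [← h1 ζ hζ]
    exact hint ζ ((hmem ζ).mp hζ)
  have h4 := smul_mem_integers (n : k)⁻¹ h3
  rwa [HahnSeries.C_mul_eq_smul, smul_smul, inv_mul_cancel₀ hn, one_smul] at h4

/-- Regularity of a function above `c`, in terms of its components. -/
theorem denom_eval_ne_zero_of_regular [IsAlgClosed k] (hn : (n : k) ≠ 0)
    (hρ : Function.Injective ρ) {c : k} (a : ℕ → RatFunc k)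
    (hreg : ∀ P ∈ fiber (k := k) (x n ρ l) (c : OnePoint k), ∑ j ∈ Finset.range n,
      algebraMap (RatFunc k) (FunctionField n ρ l) (a j) * y n ρ l ^ j ∈ P.ring)
    {i : ℕ} (hi : i < n) :
    (a i * algebraMap k[X] (RatFunc k) (g n ρ l i)).denom.eval c ≠ 0 := by
  have hn0 : n ≠ 0 := by omega
  obtain ⟨ψ, hψ⟩ := exists_finiteGerm (n := n) (ρ := ρ) (l := l) hn c
  have h1 := mem_integers_component hn ψ 1 (Or.inl rfl) a (fun ζ hζ => by
    have h2 := (hψ.twist hn0 hζ)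
    have h3 := hreg _ (h2.mem_fiber hn)
    rw [Place.mem_ofHom, ← mem_integers] at h3
    simpa using h3) hi
  rw [mul_one, one_mul, zpow_natCast] at h1
  refine hψ.denom_eval_ne_zero hn fun hb => ?_
  have ha : a i ≠ 0 := left_ne_zero_of_mul hb
  have ha' : ψ (algebraMap (RatFunc k) _ (a i)) ≠ 0 := by simpa using ha
  have hy' : ψ (y n ρ l ^ i) ≠ 0 := (map_ne_zero ψ).mpr (pow_ne_zero _ (y_ne_zero hn0))
  rw [mem_integers, map_mul, HahnSeries.order_mul ha' hy', map_pow, HahnSeries.order_pow,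
    hψ.order_y] at h1
  rw [map_mul, map_mul, ← aeval_x, HahnSeries.order_mul ha'
    (by simpa using aeval_x_ne_zero (g_ne_zero i)), hψ.order_aeval hn (g_ne_zero i),
    rootMultiplicity_g hρ]
  -- The order of `a_i` is at least `-i λ` and that of `g_i` is `e ⌊i λ / e⌋`, so the product has
  -- order at least `-(i λ mod e) > -e`.
  have h4 := Nat.div_add_mod (i * lamAt n ρ l c) (eAt n ρ l c)
  have h5 := Nat.mod_lt (i * lamAt n ρ l c) (eAt_pos (ρ := ρ) (l := l) hn c)
  zify at h4 h5
  rw [nsmul_eq_mul] at h1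
  push_cast
  linarith

/-- Regularity of a differential above `c`, in terms of its components. -/
theorem denom_eval_ne_zero_of_differential [IsAlgClosed k] (hn : (n : k) ≠ 0)
    (hρ : Function.Injective ρ) {c : k} (a : ℕ → RatFunc k)
    (hreg : ∀ P ∈ fiber (k := k) (x n ρ l) (c : OnePoint k), (∑ j ∈ Finset.range n,
      algebraMap (RatFunc k) (FunctionField n ρ l) (a j) * (y n ρ l)⁻¹ ^ j) •
        D k _ (x n ρ l) ∈ differentialStalk P)
    {i : ℕ} (hi : i < n) :
    (a i / algebraMap k[X] (RatFunc k) (g n ρ l i)).denom.eval c ≠ 0 := by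
  have hn0 : n ≠ 0 := by omega
  obtain ⟨ψ, hψ⟩ := exists_finiteGerm (n := n) (ρ := ρ) (l := l) hn c
  have hpow : ∀ j : ℕ, y n ρ l ^ ((-1 : ℤ) * j) = (y n ρ l)⁻¹ ^ j := fun j => by
    rw [neg_one_mul, zpow_neg, zpow_natCast, inv_pow]
  have h1 := mem_integers_component hn ψ (diffExpand ψ (D k _ (x n ρ l))) (Or.inr rfl) a
    (fun ζ hζ => by
      have h2 := (hψ.twist hn0 hζ)
      have h3 := diffExpand_mem_integers (hreg _ (h2.mem_fiber hn))
      rw [diffExpand_smul, h2.diffExpand_D_x] at h3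
      rw [hψ.diffExpand_D_x]
      simpa only [hpow, AlgHom.comp_apply] using h3) hi
  have he := eAt_ne_zero (ρ := ρ) (l := l) hn c
  rw [hpow] at h1
  refine hψ.denom_eval_ne_zero hn fun hb => ?_
  have ha : a i ≠ 0 := (div_ne_zero_iff.mp hb).1
  have ha' : ψ (algebraMap (RatFunc k) _ (a i)) ≠ 0 := by simpa using ha
  have hy' : ψ ((y n ρ l)⁻¹ ^ i) ≠ 0 := 
    (map_ne_zero ψ).mpr (pow_ne_zero _ (inv_ne_zero (y_ne_zero hn0)))
  rw [mem_integers, map_mul, hψ.diffExpand_D_x,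
    HahnSeries.order_mul (mul_ne_zero ha' hy') (by simpa using he), HahnSeries.order_single he,
    HahnSeries.order_mul ha' hy', map_pow, HahnSeries.order_pow, map_inv₀, order_inv,
    hψ.order_y] at h1
  rw [map_div₀, map_div₀, ← aeval_x, order_div ha'
    (by simpa using aeval_x_ne_zero (g_ne_zero i)), hψ.order_aeval hn (g_ne_zero i),
    rootMultiplicity_g hρ]
  -- Here `dx` contributes `e - 1`, so `a_i / g_i` has order at least `(i λ mod e) - (e - 1) > -e`.
  have h4 := Nat.div_add_mod (i * lamAt n ρ l c) (eAt n ρ l c)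
  have h5 := Nat.zero_le (i * lamAt n ρ l c % eAt n ρ l c)
  zify at h4 h5
  rw [nsmul_eq_mul] at h1
  push_cast
  linarith

end PlaneModel

/-! ### Expansions above `∞`. -/

section Infinity

open LaurentSeries

variable {k : Type*} [Field k] {r : ℕ} {n : ℕ} {ρ : Fin r → k} {l : Fin r → ℕ}

theorem aeval_eq_pow_mul_reverse {F : Type*} [Field F] [Algebra k F] {z : F} (hz : z ≠ 0)
    (q : k[X]) : aeval z q = z ^ q.natDegree * aeval z⁻¹ q.reverse := by
  let _ : Invertible z := invertibleOfNonzero hz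
  have := eval₂_reverse_mul_pow (algebraMap k F) z q
  rw [invOf_eq_inv] at this
  rw [aeval_def, aeval_def, ← this, mul_comm]

theorem Place.inv_aeval_inv_mem {F : Type*} [Field F] [Algebra k F] (P : Place k F) {z : F}
    (hz : z ∉ P.ring) {q : k[X]} (hq : q ≠ 0) : (aeval z⁻¹ q.reverse)⁻¹ ∈ P.ring := by
  refine P.inv_aeval_mem (c := 0) ?_ ?_
  · rw [map_zero, sub_zero, mem_nonunits_iff_inv, inv_inv]
    exact Or.inr hz
  · rw [← coeff_zero_eq_eval_zero, coeff_zero_reverse]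
    simpa using hq

theorem Place.inv_mem {F : Type*} [Field F] [Algebra k F] (P : Place k F) {z : F}
    (hz : z ∉ P.ring) : z⁻¹ ∈ P.ring :=
  (P.ring.mem_or_inv_mem z).resolve_left hz

variable [hirr : Fact (Irreducible (equation n ρ l))]

/-- `ψ` is an expansion in the parameter `1 / x` at a point above `∞`. -/
structure InfiniteGerm (ψ : FunctionField n ρ l →ₐ[k] LaurentSeries k) : Prop where
  map_x : ψ (x n ρ l) = HahnSeries.single (-1 : ℤ) 1
  order_y : (ψ (y n ρ l)).order = -(((∑ i, l i) / n : ℕ) : ℤ)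

theorem aeval_single_neg_one (q : k[X]) :
    aeval (HahnSeries.single (-1 : ℤ) 1 : LaurentSeries k) q =
      HahnSeries.single (-(q.natDegree : ℤ)) 1 *
        HahnSeries.ofPowerSeries ℤ k (aeval PowerSeries.X q.reverse) := by
  rw [aeval_eq_pow_mul_reverse (by simp), HahnSeries.single_pow, one_pow, ← aeval_ofPowerSeries,
    HahnSeries.ofPowerSeries_X, HahnSeries.inv_single, inv_one, neg_neg]
  congr 2
  simp

theorem constantCoeff_aeval_reverse (q : k[X]) :
    PowerSeries.constantCoeff (aeval PowerSeries.X q.reverse) = q.leadingCoeff := by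
  rw [constantCoeff_aeval, PowerSeries.constantCoeff_X, ← coeff_zero_eq_eval_zero,
    coeff_zero_reverse]

/-- In `T = 1 / x`, `f` is `T ^ (-deg f)` times its reverse, whose constant term is `1` because `f`
is monic. As `n ∣ deg f`, there is no ramification. Taking the root with constant term `1` fixes a
base point above `∞`. -/
theorem exists_infiniteGerm [IsAlgClosed k] (hn : (n : k) ≠ 0) (hdeg : n ∣ ∑ i, l i) :
    ∃ ψ : FunctionField n ρ l →ₐ[k] LaurentSeries k, InfiniteGerm ψ ∧
      ∃ w, PowerSeries.constantCoeff w = 1 ∧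
        ψ (y n ρ l / x n ρ l ^ ((∑ i, l i) / n)) = HahnSeries.ofPowerSeries ℤ k w := by
  obtain ⟨w, hw0, hw⟩ := PowerSeries.exists_pow_eq n hn (aeval PowerSeries.X (f ρ l).reverse) 1
    one_ne_zero (by
      rw [constantCoeff_aeval_reverse, one_pow]
      exact (monic_prod_pow l).leadingCoeff.symm)
  set L := (∑ i, l i) / n with hL
  have hLn : L * n = ∑ i, l i := Nat.div_mul_cancel hdeg
  have hword : (HahnSeries.ofPowerSeries ℤ k w).order = 0 :=
    ofPowerSeries_order w (by rw [hw0]; exact one_ne_zero)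
  have hwne : HahnSeries.ofPowerSeries ℤ k w ≠ 0 := by
    intro h
    rw [← map_zero (HahnSeries.ofPowerSeries ℤ k)] at h
    rw [HahnSeries.ofPowerSeries_injective h, map_zero] at hw0
    exact zero_ne_one hw0
  obtain ⟨ψ, h1, h2⟩ := exists_algHom (n := n) (ρ := ρ) (l := l)
    (X₀ := HahnSeries.single (-1 : ℤ) (1 : k))
    (Y₀ := HahnSeries.single (-(L : ℤ)) 1 * HahnSeries.ofPowerSeries ℤ k w)
    (order_ne_notMem_range (by rw [HahnSeries.order_single one_ne_zero]; norm_num)) (by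
      rw [aeval_single_neg_one, ← hw, natDegree_f, ← hLn, mul_pow, map_pow,
        HahnSeries.single_pow, one_pow, nsmul_eq_mul]
      push_cast
      rw [mul_neg, mul_comm (n : ℤ)])
  refine ⟨ψ, ⟨h1, ?_⟩, w, hw0, ?_⟩
  · rw [h2, HahnSeries.order_mul (by simp) hwne, HahnSeries.order_single one_ne_zero, hword,
      add_zero]
  · rw [map_div₀, map_pow, h1, h2, HahnSeries.single_pow, one_pow, nsmul_eq_mul, mul_neg_one,
      mul_div_cancel_left₀ _ (by simp)]

namespace InfiniteGerm

variable {ψ : FunctionField n ρ l →ₐ[k] LaurentSeries k}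

theorem order_aeval (h : InfiniteGerm ψ) {q : k[X]} (hq : q ≠ 0) :
    (ψ (aeval (x n ρ l) q)).order = -(q.natDegree : ℤ) := by
  have h1 : PowerSeries.constantCoeff (aeval (PowerSeries.X : PowerSeries k) q.reverse) ≠ 0 := by
    rw [constantCoeff_aeval_reverse]; simpa using hq
  have h2 : HahnSeries.ofPowerSeries ℤ k (aeval PowerSeries.X q.reverse) ≠ 0 := by
    intro h
    rw [← map_zero (HahnSeries.ofPowerSeries ℤ k)] at h
    rw [HahnSeries.ofPowerSeries_injective h, map_zero] at h1
    exact h1 rfl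
  rw [algHom_aeval_x, h.map_x, aeval_single_neg_one, HahnSeries.order_mul (by simp) h2,
    HahnSeries.order_single one_ne_zero, ofPowerSeries_order _ h1, add_zero]

theorem twist [IsAlgClosed k] (h : InfiniteGerm ψ) (hn : n ≠ 0) {ζ : k} (hζ : ζ ^ n = 1) :
    InfiniteGerm (ψ.comp (twist n ρ l ζ)) where
  map_x := by rw [AlgHom.comp_apply, twist_x, h.map_x]
  order_y := by rw [twist_order_y ψ hn hζ, h.order_y]

theorem order_x (h : InfiniteGerm ψ) : (ψ (x n ρ l)).order = -1 := by
  rw [h.map_x, HahnSeries.order_single one_ne_zero]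

theorem notMem_integers [IsAlgClosed k] (h : InfiniteGerm ψ) (ζ : k) :
    ∃ a, ψ.comp (KummerCurve.twist n ρ l ζ) a ∉ integers k := by
  refine ⟨x n ρ l, ?_⟩
  rw [AlgHom.comp_apply, twist_x, mem_integers, h.order_x]
  norm_num

/-- The point above `∞` obtained from a base point by the automorphism `y ↦ ζ y`. -/
def place [IsAlgClosed k] (h : InfiniteGerm ψ) (ζ : k) : Place k (FunctionField n ρ l) :=
  Place.ofHom (ψ.comp (KummerCurve.twist n ρ l ζ)) (h.notMem_integers ζ)

theorem place_mem_fiber [IsAlgClosed k] (h : InfiniteGerm ψ) (ζ : k) :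
    h.place ζ ∈ fiber (x n ρ l) (OnePoint.infty : OnePoint k) := by
  change x n ρ l ∉ (h.place ζ).ring
  rw [place, Place.mem_ofHom, AlgHom.comp_apply, twist_x, h.order_x]
  norm_num

/-- The hypothesis says that the numerator has degree at most that of the denominator, which does
not involve `P`; rewriting in `1 / x` then gives regularity at any pole of `x`. -/
theorem ratFunc_mem (h : InfiniteGerm ψ) {P : Place k (FunctionField n ρ l)}
    (hP : x n ρ l ∉ P.ring) {b : RatFunc k}
    (hb : 0 ≤ (ψ (algebraMap (RatFunc k) _ b)).order) :
    algebraMap (RatFunc k) _ b ∈ P.ring := by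
  rcases eq_or_ne b 0 with rfl | hb0
  · rw [map_zero]; exact zero_mem _
  have hN0 : b.num ≠ 0 := RatFunc.num_ne_zero hb0
  have hD0 : b.denom ≠ 0 := RatFunc.denom_ne_zero b
  have hx0 : x n ρ l ≠ 0 := x_ne_zero
  rw [algebraMap_ratFunc_eq, map_div₀, order_div (by simpa using aeval_x_ne_zero hN0)
    (by simpa using aeval_x_ne_zero hD0), h.order_aeval hN0, h.order_aeval hD0] at hb
  obtain ⟨d, hd⟩ : ∃ d, b.denom.natDegree = b.num.natDegree + d :=
    Nat.exists_eq_add_of_le (by omega)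
  have e1 : algebraMap (RatFunc k) (FunctionField n ρ l) b = (x n ρ l)⁻¹ ^ d *
      aeval (x n ρ l)⁻¹ b.num.reverse * (aeval (x n ρ l)⁻¹ b.denom.reverse)⁻¹ := by
    rw [algebraMap_ratFunc_eq, aeval_eq_pow_mul_reverse hx0 b.num,
      aeval_eq_pow_mul_reverse hx0 b.denom, hd, pow_add, inv_pow]
    field_simp
  rw [e1]
  have hinv := P.inv_mem hP
  exact mul_mem (mul_mem (pow_mem hinv _) (P.aeval_mem hinv _)) (P.inv_aeval_inv_mem hP hD0)

/-- A function that is regular at all the points `h.place ζ` is regular at each point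
above `∞`. -/
theorem mem_of_forall_place [IsAlgClosed k] (hn : (n : k) ≠ 0) (h : InfiniteGerm ψ)
    {P : Place k (FunctionField n ρ l)} (hP : x n ρ l ∉ P.ring) {G : FunctionField n ρ l}
    (hG : ∀ ζ : k, ζ ^ n = 1 → G ∈ (h.place ζ).ring) : G ∈ P.ring := by
  have hn0 : n ≠ 0 := by rintro rfl; simp at hn
  obtain ⟨a, rfl⟩ := exists_sum_pow hn0 G
  -- The `n`-th power of each term lies in `k(x)`, where regularity at one point above `∞` implies
  -- it at all.
  refine sum_mem fun j hj => mem_of_pow_mem _ hn0 ?_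
  have h1 := mem_integers_component hn ψ 1 (Or.inl rfl) a (fun ζ hζ => by
    have h3 := hG ζ hζ
    rw [place, Place.mem_ofHom, ← mem_integers] at h3
    simpa using h3) (Finset.mem_range.mp hj)
  rw [mul_one, one_mul, zpow_natCast] at h1
  have h2 : (algebraMap (RatFunc k) (FunctionField n ρ l) (a j) * y n ρ l ^ j) ^ n =
      algebraMap (RatFunc k) _ (a j ^ n * algebraMap k[X] (RatFunc k) (f ρ l) ^ j) := by
    rw [mul_pow, ← pow_mul, mul_comm j n, pow_mul, y_pow, aeval_x]
    simp only [map_mul, map_pow]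
  rw [h2]
  apply h.ratFunc_mem hP
  rw [← h2, ← mem_integers, map_pow]
  exact pow_mem h1 n

end InfiniteGerm

theorem prod_sub_rootsOfUnity [IsAlgClosed k] (hn : (n : k) ≠ 0) {F : Type*} [Field F] [Algebra k F]
    (v : F) : ∏ ζ ∈ nthRootsFinset n (1 : k), (v - algebraMap k F ζ) = v ^ n - 1 := by
  have hn0 : 0 < n := Nat.pos_of_ne_zero (by rintro rfl; simp at hn)
  have : NeZero (n : k) := ⟨hn⟩
  obtain ⟨z, hz⟩ := HasEnoughRootsOfUnity.exists_primitiveRoot k n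
  have := congrArg (aeval v) (X_pow_sub_one_eq_prod hn0 hz)
  rw [map_prod] at this
  simpa using this.symm

/-- For `v = y / x ^ L`, `v ^ n` is the reverse of `f` at `1 / x`, congruent to `1` at `P`. So `∏ (v
- ζ) = v ^ n - 1` is a nonunit, and one of its factors must be. -/
theorem exists_sub_mem_nonunits [IsAlgClosed k] (hn : (n : k) ≠ 0) (hdeg : n ∣ ∑ i, l i)
    {P : Place k (FunctionField n ρ l)} (hP : x n ρ l ∉ P.ring) :
    ∃ ζ : k, ζ ^ n = 1 ∧
      y n ρ l / x n ρ l ^ ((∑ i, l i) / n) - algebraMap k _ ζ ∈ P.ring.nonunits := by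
  have hn0 : 0 < n := Nat.pos_of_ne_zero (by rintro rfl; simp at hn)
  by_contra! hno
  set v := y n ρ l / x n ρ l ^ ((∑ i, l i) / n) with hv
  have hx0 : x n ρ l ≠ 0 := x_ne_zero
  have h1 : v ^ n = aeval (x n ρ l)⁻¹ (f ρ l).reverse := by
    rw [hv, div_pow, y_pow, aeval_eq_pow_mul_reverse hx0, natDegree_f, ← pow_mul,
      Nat.div_mul_cancel hdeg, mul_div_cancel_left₀ _ (pow_ne_zero _ hx0)]
  have h2 : v ^ n - 1 ∈ P.ring.nonunits := by
    rw [mem_nonunits_iff_inv]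
    by_contra! hc
    obtain ⟨q, hq⟩ := X_sub_C_dvd_sub_C_eval (a := 0) (p := (f ρ l).reverse)
    rw [← coeff_zero_eq_eval_zero, coeff_zero_reverse, f, (monic_prod_pow l).leadingCoeff, ← f,
      C_0, sub_zero] at hq
    have h4 := congrArg (aeval (x n ρ l)⁻¹) hq
    rw [map_sub, map_mul, aeval_X, map_one, map_one, ← h1] at h4
    -- Since `x (v ^ n - 1)` is a polynomial in `1 / x`, a unit `v ^ n - 1` would make `x` regular
    -- at `P`.
    have h5 : x n ρ l = aeval (x n ρ l)⁻¹ q * (v ^ n - 1)⁻¹ := by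
      rw [eq_mul_inv_iff_mul_eq₀ hc.1, h4, mul_inv_cancel_left₀ hx0]
    exact hP (h5 ▸ mul_mem (P.aeval_mem (P.inv_mem hP) _) hc.2)
  rw [mem_nonunits_iff_inv, ← prod_sub_rootsOfUnity hn] at h2
  have h3 : ∀ ζ ∈ nthRootsFinset n (1 : k), v - algebraMap k _ ζ ≠ 0 ∧
      (v - algebraMap k _ ζ)⁻¹ ∈ P.ring := fun ζ hζ => by
    have := hno ζ ((Polynomial.mem_nthRootsFinset hn0 1).mp hζ)
    rw [mem_nonunits_iff_inv] at this
    push Not at this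
    exact this
  rcases h2 with h2 | h2
  · exact Finset.prod_ne_zero_iff.mpr (fun ζ hζ => (h3 ζ hζ).1) h2
  · apply h2
    rw [← Finset.prod_inv_distrib]
    exact prod_mem fun ζ hζ => (h3 ζ hζ).2

end Infinity

/-! ### The points above `∞` are indexed by the `n`-th roots of unity. -/

section PlacesAtInfinity

open LaurentSeries

variable {k : Type*} [Field k] {r : ℕ} {n : ℕ} {ρ : Fin r → k} {l : Fin r → ℕ}

theorem Place.eq_of_sub_mem_nonunits {F : Type*} [Field F] [Algebra k F] (P : Place k F) {v : F}
    {a b : k} (ha : v - algebraMap k F a ∈ P.ring.nonunits)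
    (hb : v - algebraMap k F b ∈ P.ring.nonunits) : a = b := by
  by_contra hab
  refine P.algebraMap_notMem_nonunits (sub_ne_zero.mpr hab) ?_
  have h := add_mem_nonunits hb (mul_mem_nonunits ha (neg_mem (one_mem P.ring)))
  rw [map_sub]
  convert h using 1
  ring

theorem Place.pow_mul_mem_ofHom {F : Type*} [Field F] [Algebra k F]
    {φ : F →ₐ[k] LaurentSeries k} {h : ∃ a, φ a ∉ integers k} {q G : F}
    (hq : q ∈ (Place.ofHom φ h).ring.nonunits) {N : ℕ} (hN : (φ G).order.natAbs ≤ N) :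
    q ^ N * G ∈ (Place.ofHom φ h).ring := by
  rcases eq_or_ne G 0 with rfl | hG
  · rw [mul_zero]; exact zero_mem _
  rcases (Place.mem_nonunits_ofHom).mp hq with rfl | h1
  · rcases Nat.eq_zero_or_pos N with rfl | hN0
    · rw [pow_zero, one_mul, Place.mem_ofHom]; omega
    · rw [zero_pow hN0.ne', zero_mul]; exact zero_mem _
  · have hq0 : φ q ≠ 0 := by intro h0; rw [h0] at h1; simp at h1
    rw [Place.mem_ofHom, map_mul, map_pow, HahnSeries.order_mul (pow_ne_zero _ hq0)
      ((_root_.map_ne_zero φ).mpr hG), HahnSeries.order_pow, nsmul_eq_mul]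
    have h3 : (N : ℤ) * 1 ≤ N * (φ q).order := by gcongr
    omega

variable [hirr : Fact (Irreducible (equation n ρ l))] [IsAlgClosed k]

namespace InfiniteGerm

variable {ψ : FunctionField n ρ l →ₐ[k] LaurentSeries k}

/-- The expansion of `y / x ^ L` at the base point has constant coefficient `1`. -/
def IsNormalized (ψ : FunctionField n ρ l →ₐ[k] LaurentSeries k) : Prop :=
  ∃ w, PowerSeries.constantCoeff w = 1 ∧
    ψ (y n ρ l / x n ρ l ^ ((∑ i, l i) / n)) = HahnSeries.ofPowerSeries ℤ k w

theorem sub_mem_nonunits_place (h : InfiniteGerm ψ) (hw : IsNormalized ψ) {ζ : k}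
    (hζ : ζ ^ n = 1) :
    y n ρ l / x n ρ l ^ ((∑ i, l i) / n) - algebraMap k _ ζ ∈ (h.place ζ).ring.nonunits := by
  obtain ⟨w, hw0, hw⟩ := hw
  have h1 : ψ (KummerCurve.twist n ρ l ζ
      (y n ρ l / x n ρ l ^ ((∑ i, l i) / n) - algebraMap k _ ζ)) =
      HahnSeries.ofPowerSeries ℤ k (PowerSeries.C ζ * (w - 1)) := by
    rw [map_sub, map_div₀, map_pow, twist_x, twist_y hζ, AlgHom.commutes, mul_div_assoc, map_sub,
      map_algebraMap_mul, hw, AlgHom.commutes, algebraMap_eq_C, map_mul,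
      HahnSeries.ofPowerSeries_C, map_sub, map_one]
    ring
  obtain ⟨w₁, hw₁⟩ : PowerSeries.X ∣ PowerSeries.C ζ * (w - 1) := by
    rw [PowerSeries.X_dvd_iff]; simp [hw0]
  rw [place, Place.mem_nonunits_ofHom, or_iff_not_imp_left]
  intro hne
  rw [AlgHom.comp_apply, h1, hw₁, map_mul, HahnSeries.ofPowerSeries_X]
  have h2 : HahnSeries.ofPowerSeries ℤ k w₁ ≠ 0 := by
    intro h0
    apply hne
    rw [hw₁, map_mul, h0, mul_zero] at h1
    exact (_root_.map_eq_zero _).mp ((_root_.map_eq_zero _).mp h1)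
  rw [HahnSeries.order_mul (by simp) h2, HahnSeries.order_single one_ne_zero]
  have := (mem_range_ofPowerSeries_iff _).mp ⟨w₁, rfl⟩
  omega

theorem place_injOn (h : InfiniteGerm ψ) (hw : IsNormalized ψ) :
    Set.InjOn h.place {ζ | ζ ^ n = 1} := by
  intro ζ hζ ζ' hζ' heq
  have h1 := h.sub_mem_nonunits_place hw hζ
  rw [heq] at h1
  exact Place.eq_of_sub_mem_nonunits _ h1 (h.sub_mem_nonunits_place hw hζ')

/-- The product `q` of `v - ζ'` over `ζ' ≠ ζ` is a unit at `P` and vanishes at the other points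
`h.place ζ'`. If `G` is regular at `h.place ζ`, then `q ^ N * G` is regular at all of them for large
`N`, hence at `P`, and so is `G`. This gives one inclusion of local rings. -/
theorem eq_place (hn : (n : k) ≠ 0) (h : InfiniteGerm ψ) (hw : IsNormalized ψ)
    {P : Place k (FunctionField n ρ l)} (hP : x n ρ l ∉ P.ring) {ζ : k} (hζ : ζ ^ n = 1)
    (hv : y n ρ l / x n ρ l ^ ((∑ i, l i) / n) - algebraMap k _ ζ ∈ P.ring.nonunits) :
    P = h.place ζ := by
  classical
  have hn0 : 0 < n := Nat.pos_of_ne_zero (by rintro rfl; simp at hn)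
  have hmem : ∀ ζ : k, ζ ∈ nthRootsFinset n (1 : k) ↔ ζ ^ n = 1 := fun ζ =>
    Polynomial.mem_nthRootsFinset hn0 1
  set v := y n ρ l / x n ρ l ^ ((∑ i, l i) / n) with hv_def
  have hsub : ∀ G ∈ (h.place ζ).ring, G ∈ P.ring := by
    intro G hG
    set q := ∏ ζ' ∈ (nthRootsFinset n (1 : k)).erase ζ, (v - algebraMap k _ ζ') with hq
    have hqinv : q⁻¹ ∈ P.ring := by
      rw [hq, ← Finset.prod_inv_distrib]
      refine prod_mem fun ζ' hζ' => ?_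
      by_contra hc
      have := P.eq_of_sub_mem_nonunits hv ((mem_nonunits_iff_inv _ _).mpr (Or.inr hc))
      exact (Finset.mem_erase.mp hζ').1 this.symm
    have hq0 : q ≠ 0 := by
      refine Finset.prod_ne_zero_iff.mpr fun ζ' hζ' h0 => ?_
      have := P.eq_of_sub_mem_nonunits hv (b := ζ') (by
        rw [h0]; exact (mem_nonunits_iff_inv _ _).mpr (Or.inl rfl))
      exact (Finset.mem_erase.mp hζ').1 this.symm
    have hvmem : ∀ ζ' : k, ζ' ^ n = 1 → v ∈ (h.place ζ').ring := fun ζ' hζ' => by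
      have := add_mem (mem_of_mem_nonunits (h.sub_mem_nonunits_place hw hζ'))
        ((h.place ζ').algebraMap_mem ζ')
      rwa [sub_add_cancel] at this
    set N := ∑ ζ' ∈ nthRootsFinset n (1 : k),
      ((ψ.comp (KummerCurve.twist n ρ l ζ')) G).order.natAbs with hN
    have hqG : q ^ N * G ∈ P.ring := by
      refine h.mem_of_forall_place hn hP fun ζ' hζ' => ?_
      have hqmem : q ∈ (h.place ζ').ring :=
        prod_mem fun ζ'' _ => sub_mem (hvmem ζ' hζ') ((h.place ζ').algebraMap_mem ζ'')
      rcases eq_or_ne ζ' ζ with rfl | hne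
      · exact mul_mem (pow_mem hqmem _) hG
      · have hqnon : q ∈ (h.place ζ').ring.nonunits := by
          rw [hq, ← Finset.mul_prod_erase _ _ (Finset.mem_erase.mpr ⟨hne, (hmem ζ').mpr hζ'⟩)]
          exact mul_mem_nonunits (h.sub_mem_nonunits_place hw hζ')
            (prod_mem fun ζ'' _ => sub_mem (hvmem ζ' hζ') ((h.place ζ').algebraMap_mem ζ''))
        exact Place.pow_mul_mem_ofHom hqnon (Finset.single_le_sum
          (f := fun ζ' => ((ψ.comp (KummerCurve.twist n ρ l ζ')) G).order.natAbs)
          (fun _ _ => Nat.zero_le _) ((hmem ζ').mpr hζ'))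
    have h4 : G = q⁻¹ ^ N * (q ^ N * G) := by
      rw [inv_pow, inv_mul_cancel_left₀ (pow_ne_zero _ hq0)]
    rw [h4]
    exact mul_mem (pow_mem hqinv _) hqG
  refine Place.ext (le_antisymm (fun G hG => ?_) hsub)
  by_contra hG'
  have hG0 : G ≠ 0 := by rintro rfl; exact hG' (zero_mem _)
  have h1 := hG'
  rw [place, Place.mem_ofHom] at h1
  -- For the reverse inclusion: `G` has a pole at `h.place ζ`, where `x` has a simple one, so `x /
  -- G` is regular there, hence at `P`. Then `x = (x / G) G` would be regular at `P`.
  have h2 : x n ρ l * G⁻¹ ∈ (h.place ζ).ring := by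
    rw [place, Place.mem_ofHom, map_mul, HahnSeries.order_mul ((_root_.map_ne_zero _).mpr x_ne_zero)
      ((_root_.map_ne_zero _).mpr (inv_ne_zero hG0)), map_inv₀, order_inv, AlgHom.comp_apply, twist_x,
      h.order_x]
    omega
  apply hP
  have := mul_mem (hsub _ h2) hG
  rwa [inv_mul_cancel_right₀ hG0] at this

theorem image_place (hn : (n : k) ≠ 0) (hdeg : n ∣ ∑ i, l i) (h : InfiniteGerm ψ)
    (hw : IsNormalized ψ) :
    h.place '' (nthRootsFinset n (1 : k)) = fiber (x n ρ l) (OnePoint.infty : OnePoint k) := by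
  have hn0 : 0 < n := Nat.pos_of_ne_zero (by rintro rfl; simp at hn)
  ext P
  constructor
  · rintro ⟨ζ, -, rfl⟩
    exact h.place_mem_fiber ζ
  · intro hP
    obtain ⟨ζ, hζ, hv⟩ := exists_sub_mem_nonunits hn hdeg hP
    exact ⟨ζ, (Polynomial.mem_nthRootsFinset hn0 1).mpr hζ, (h.eq_place hn hw hP hζ hv).symm⟩

end InfiniteGerm

end PlacesAtInfinity

/-! ### `Ω_F = F dx`, and the sum of residues above `∞`. -/

section Differentials

open LaurentSeries

variable {k : Type*} [Field k] {r : ℕ} {n : ℕ} {ρ : Fin r → k} {l : Fin r → ℕ}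
  [hirr : Fact (Irreducible (equation n ρ l))]

theorem D_y (hn : (n : k) ≠ 0) : D k (FunctionField n ρ l) (y n ρ l) =
    (aeval (x n ρ l) (derivative (f ρ l)) / (n * y n ρ l ^ (n - 1))) •
      D k (FunctionField n ρ l) (x n ρ l) := by
  have hn0 : n ≠ 0 := by rintro rfl; simp at hn
  have hnF : (n : FunctionField n ρ l) ≠ 0 := by
    rw [← map_natCast (algebraMap k (FunctionField n ρ l))]
    exact (_root_.map_ne_zero _).mpr hn
  have h := congrArg (D k (FunctionField n ρ l)) (y_pow (n := n) (ρ := ρ) (l := l))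
  rw [Derivation.leibniz_pow, Derivation.map_aeval, ← Nat.cast_smul_eq_nsmul (FunctionField n ρ l),
    smul_smul] at h
  have hne : (n : FunctionField n ρ l) * y n ρ l ^ (n - 1) ≠ 0 :=
    mul_ne_zero hnF (pow_ne_zero _ (y_ne_zero hn0))
  rw [div_eq_inv_mul, mul_smul, ← h, smul_smul, inv_mul_cancel₀ hne, one_smul]

/-- `Ω_F` is generated by `dx`. -/
theorem exists_eq_smul_D_x (hn : (n : k) ≠ 0) (η : Ω[FunctionField n ρ l⁄k]) :
    ∃ G : FunctionField n ρ l, η = G • D k (FunctionField n ρ l) (x n ρ l) := by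
  have hn0 : n ≠ 0 := by rintro rfl; simp at hn
  set S := Submodule.span (FunctionField n ρ l) {D k (FunctionField n ρ l) (x n ρ l)} with hS
  have hx : D k (FunctionField n ρ l) (x n ρ l) ∈ S := Submodule.mem_span_singleton_self _
  have hpoly : ∀ q : k[X], D k (FunctionField n ρ l) (aeval (x n ρ l) q) ∈ S := fun q => by
    rw [Derivation.map_aeval]
    exact S.smul_mem _ hx
  have hD : ∀ b, D k (FunctionField n ρ l) b ∈ S := by
    intro b
    obtain ⟨a, rfl⟩ := exists_sum_pow hn0 b
    rw [map_sum]
    refine sum_mem fun j _ => ?_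
    rw [Derivation.leibniz, Derivation.leibniz_pow, D_y hn, algebraMap_ratFunc_eq,
      Derivation.leibniz_div]
    exact add_mem (S.smul_mem _ (S.smul_of_tower_mem (j : ℕ) (S.smul_mem _ (S.smul_mem _ hx))))
      (S.smul_mem _ (S.smul_mem _ (sub_mem (S.smul_mem _ (hpoly _)) (S.smul_mem _ (hpoly _)))))
  have htop : S = ⊤ := by
    rw [eq_top_iff, ← KaehlerDifferential.span_range_derivation, Submodule.span_le]
    rintro _ ⟨b, rfl⟩
    exact hD b
  obtain ⟨G, hG⟩ := Submodule.mem_span_singleton.mp (htop ▸ Submodule.mem_top : η ∈ S)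
  exact ⟨G, hG.symm⟩

/-- Above `∞` the uniformizer is `1 / x`, so differentials there must be written with `d(1 / x)`. -/
theorem D_x_eq : D k (FunctionField n ρ l) (x n ρ l) =
    (-(x n ρ l ^ 2)) • D k (FunctionField n ρ l) (x n ρ l)⁻¹ := by
  have hx0 : x n ρ l ≠ 0 := x_ne_zero
  rw [Derivation.leibniz_inv, smul_smul]
  have : -(x n ρ l ^ 2) * -(x n ρ l)⁻¹ ^ 2 = 1 := by field_simp
  rw [this, one_smul]

namespace InfiniteGerm

variable {ψ : FunctionField n ρ l →ₐ[k] LaurentSeries k}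

theorem residue_place [IsAlgClosed k] (hn : (n : k) ≠ 0) (h : InfiniteGerm ψ) (ζ : k)
    (η : Ω[FunctionField n ρ l⁄k]) :
    residue (h.place ζ) η =
      (diffExpand (ψ.comp (KummerCurve.twist n ρ l ζ)) η).coeff (-1) := by
  obtain ⟨G, rfl⟩ := exists_eq_smul_D_x hn η
  rw [D_x_eq, smul_smul, place]
  refine residue_ofHom ?_ _
  rw [AlgHom.comp_apply, map_inv₀, twist_x, map_inv₀, h.map_x]
  simp

theorem diffExpand_D_x (h : InfiniteGerm ψ) :
    diffExpand ψ (D k _ (x n ρ l)) = HahnSeries.single (-2 : ℤ) (-1 : k) := by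
  rw [diffExpand_D, h.map_x, derivative_single]
  norm_num

/-- The sum of the residues at the points above `∞`. -/
theorem finsum_residue [IsAlgClosed k] (hn : (n : k) ≠ 0) (hdeg : n ∣ ∑ i, l i) (h : InfiniteGerm ψ)
    (hw : IsNormalized ψ) (η : Ω[FunctionField n ρ l⁄k]) :
    ∑ᶠ P ∈ fiber (x n ρ l) (OnePoint.infty : OnePoint k), residue P η =
      ∑ ζ ∈ nthRootsFinset n (1 : k),
        (diffExpand (ψ.comp (KummerCurve.twist n ρ l ζ)) η).coeff (-1) := by
  have hn0 : 0 < n := Nat.pos_of_ne_zero (by rintro rfl; simp at hn)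
  rw [← h.image_place hn hdeg hw, finsum_mem_image, finsum_mem_coe_finset]
  · exact Finset.sum_congr rfl fun ζ _ => h.residue_place hn ζ η
  · exact (h.place_injOn hw).mono fun ζ hζ => (Polynomial.mem_nthRootsFinset hn0 1).mp hζ

end InfiniteGerm

end Differentials

/-! ### Where the monomials `x ^ j y ^ μ / g_μ` are regular. -/

section Membership

open LaurentSeries

variable {k : Type*} [Field k] {r : ℕ} {n : ℕ} {ρ : Fin r → k} {l : Fin r → ℕ}

theorem ratFunc_X_zpow_div_g_ne_zero (μ : ℕ) (j : ℤ) :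
    RatFunc.X ^ j / algebraMap k[X] (RatFunc k) (g n ρ l μ) ≠ 0 :=
  div_ne_zero (zpow_ne_zero _ RatFunc.X_ne_zero) (by simpa using g_ne_zero μ)

variable [hirr : Fact (Irreducible (equation n ρ l))]

/-- The `n`-th power of a monomial lies in `k(x)`. Hence an order computed at a single germ decides
regularity at every place of the fibre, and the places above finite points need not be classified.
-/
theorem monomial_pow (a : RatFunc k) (i : ℤ) :
    (algebraMap (RatFunc k) (FunctionField n ρ l) a * y n ρ l ^ i) ^ n =
      algebraMap (RatFunc k) _ (a ^ n * algebraMap k[X] (RatFunc k) (f ρ l) ^ i) := by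
  rw [mul_pow, ← zpow_natCast (y n ρ l ^ i), ← zpow_mul, mul_comm i, zpow_mul, zpow_natCast,
    y_pow, aeval_x]
  simp only [map_mul, map_pow, map_zpow₀]

theorem InfiniteGerm.monomial_mem (hn : n ≠ 0)
    {ψ : FunctionField n ρ l →ₐ[k] LaurentSeries k} (h : InfiniteGerm ψ)
    {P : Place k (FunctionField n ρ l)} (hP : x n ρ l ∉ P.ring) {a : RatFunc k} {i : ℤ}
    (ha : 0 ≤ (ψ (algebraMap (RatFunc k) _ a * y n ρ l ^ i)).order) :
    algebraMap (RatFunc k) _ a * y n ρ l ^ i ∈ P.ring := by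
  refine mem_of_pow_mem _ hn ?_
  rw [monomial_pow]
  apply h.ratFunc_mem hP
  rw [← monomial_pow, ← mem_integers, map_pow]
  exact pow_mem (mem_integers.mpr ha) n

theorem mem_fiber_coe {F : Type*} [Field F] [Algebra k F] {z : F} {c : k} {P : Place k F} :
    P ∈ fiber z (c : OnePoint k) ↔ z - algebraMap k F c ∈ P.ring.nonunits := Iff.rfl

theorem mem_ring_of_mem_fiber {F : Type*} [Field F] [Algebra k F] {z : F} {c : k} {P : Place k F}
    (hP : P ∈ fiber z (c : OnePoint k)) : z ∈ P.ring := by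
  have := add_mem (mem_of_mem_nonunits (mem_fiber_coe.mp hP)) (P.algebraMap_mem c)
  rwa [sub_add_cancel] at this

theorem FiniteGerm.monomial_mem (hn : (n : k) ≠ 0) {c : k}
    {ψ : FunctionField n ρ l →ₐ[k] LaurentSeries k} (h : FiniteGerm c ψ)
    {P : Place k (FunctionField n ρ l)} (hP : P ∈ fiber (x n ρ l) (c : OnePoint k))
    {a : RatFunc k} {i : ℤ}
    (ha : 0 ≤ (ψ (algebraMap (RatFunc k) _ a * y n ρ l ^ i)).order) :
    algebraMap (RatFunc k) _ a * y n ρ l ^ i ∈ P.ring := by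
  have hn0 : n ≠ 0 := by rintro rfl; simp at hn
  refine mem_of_pow_mem _ hn0 ?_
  rw [monomial_pow, algebraMap_ratFunc_eq, div_eq_mul_inv]
  refine mul_mem (P.aeval_mem (mem_ring_of_mem_fiber hP) _)
    (P.inv_aeval_mem (mem_fiber_coe.mp hP) (h.denom_eval_ne_zero hn fun _ => ?_))
  rw [← monomial_pow, map_pow, HahnSeries.order_pow, nsmul_eq_mul]
  have := eAt_pos (ρ := ρ) (l := l) hn c
  have : 0 ≤ (n : ℤ) * (ψ (algebraMap (RatFunc k) _ a * y n ρ l ^ i)).order := by positivity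
  omega

theorem order_monomial (hn : n ≠ 0) (ψ : FunctionField n ρ l →ₐ[k] LaurentSeries k) {a : RatFunc k}
    (ha : a ≠ 0) (i : ℤ) : (ψ (algebraMap (RatFunc k) _ a * y n ρ l ^ i)).order =
      (ψ (algebraMap (RatFunc k) _ a)).order + i * (ψ (y n ρ l)).order := by
  rw [map_mul, HahnSeries.order_mul (by simpa using ha)
    ((_root_.map_ne_zero ψ).mpr (zpow_ne_zero _ (y_ne_zero hn))), map_zpow₀, order_zpow]

/-- The function `x ^ j y ^ μ / g_μ`. -/
def regularMonomial (n : ℕ) (ρ : Fin r → k) (l : Fin r → ℕ) [Fact (Irreducible (equation n ρ l))]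
    (μ : ℕ) (j : ℤ) : FunctionField n ρ l :=
  algebraMap (RatFunc k) _ (RatFunc.X ^ j / algebraMap k[X] (RatFunc k) (g n ρ l μ)) *
    y n ρ l ^ (μ : ℤ)

theorem algebraMap_X_zpow_div_g (μ : ℕ) (j : ℤ) :
    algebraMap (RatFunc k) (FunctionField n ρ l)
      (RatFunc.X ^ j / algebraMap k[X] (RatFunc k) (g n ρ l μ)) =
      aeval (x n ρ l) (X : k[X]) ^ j / aeval (x n ρ l) (g n ρ l μ) := by
  rw [map_div₀, map_zpow₀, aeval_x, aeval_x, RatFunc.algebraMap_X]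

/-- The order of `y ^ μ / g_μ` is the remainder of `μ λ` modulo `e`, and `x ^ j` contributes only
when `c = 0`. -/
theorem regularMonomial_mem_of_finite [IsAlgClosed k] (hn : (n : k) ≠ 0)
    (hρ : Function.Injective ρ) {c : k} {P : Place k (FunctionField n ρ l)}
    (hP : P ∈ fiber (x n ρ l) (c : OnePoint k)) (μ : ℕ) {j : ℤ} (hj : 0 ≤ j ∨ c ≠ 0) :
    regularMonomial n ρ l μ j ∈ P.ring := by
  have hn0 : n ≠ 0 := by rintro rfl; simp at hn
  obtain ⟨ψ, hψ⟩ := exists_finiteGerm (n := n) (ρ := ρ) (l := l) hn c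
  refine hψ.monomial_mem hn hP ?_
  rw [order_monomial hn0 ψ (ratFunc_X_zpow_div_g_ne_zero μ j), algebraMap_X_zpow_div_g, map_div₀,
    order_div ((_root_.map_ne_zero ψ).mpr (zpow_ne_zero _ (aeval_x_ne_zero X_ne_zero)))
    ((_root_.map_ne_zero ψ).mpr (aeval_x_ne_zero (g_ne_zero μ))), map_zpow₀, order_zpow,
    hψ.order_aeval hn X_ne_zero, hψ.order_aeval hn (g_ne_zero μ), hψ.order_y,
    rootMultiplicity_g hρ]
  have h1 : 0 ≤ j * ((eAt n ρ l c : ℤ) * ((X : k[X]).rootMultiplicity c : ℕ)) := by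
    rcases hj with hj | hj
    · positivity
    · rw [rootMultiplicity_eq_zero (by simpa using hj)]; simp
  have h2 := Nat.mul_div_le (μ * lamAt n ρ l c) (eAt n ρ l c)
  zify at h2
  push_cast
  linarith

/-- By `degree_identity` the order above `∞` is `-j - t^{(μ)}`. -/
theorem regularMonomial_mem_of_infinite [IsAlgClosed k] (hn : (n : k) ≠ 0)
    (hdeg : n ∣ ∑ i, l i) {P : Place k (FunctionField n ρ l)} (hP : x n ρ l ∉ P.ring)
    (μ : ℕ) {j : ℤ} (hj : j ≤ -(t n l μ : ℤ)) :
    regularMonomial n ρ l μ j ∈ P.ring := by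
  have hn0 : n ≠ 0 := by rintro rfl; simp at hn
  obtain ⟨ψ, hψ, -⟩ := exists_infiniteGerm (n := n) (ρ := ρ) (l := l) hn hdeg
  refine hψ.monomial_mem hn0 hP ?_
  rw [order_monomial hn0 ψ (ratFunc_X_zpow_div_g_ne_zero μ j), algebraMap_X_zpow_div_g, map_div₀,
    order_div ((_root_.map_ne_zero ψ).mpr (zpow_ne_zero _ (aeval_x_ne_zero X_ne_zero)))
    ((_root_.map_ne_zero ψ).mpr (aeval_x_ne_zero (g_ne_zero μ))), map_zpow₀, order_zpow,
    hψ.order_aeval X_ne_zero, hψ.order_aeval (g_ne_zero μ), hψ.order_y, natDegree_X, natDegree_g]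
  have := degree_identity (l := l) hn0 hdeg μ
  zify at this
  push_cast
  linarith

theorem regularMonomial_mem_U_infty [IsAlgClosed k] (hn : (n : k) ≠ 0)
    (hρ : Function.Injective ρ) (μ : ℕ) {j : ℤ} (hj : 0 ≤ j) :
    regularMonomial n ρ l μ j ∈
      regularFunctions (U (x n ρ l) (OnePoint.infty : OnePoint k)) := by
  intro P hP
  have hn0 : n ≠ 0 := by rintro rfl; simp at hn
  obtain ⟨a, ha⟩ := exists_mem_fiber hn0 P
  induction a using OnePoint.rec with
  | infty => exact absurd ha hP
  | coe c => exact regularMonomial_mem_of_finite hn hρ ha μ (Or.inl hj)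

theorem regularMonomial_mem_U_zero [IsAlgClosed k] (hn : (n : k) ≠ 0)
    (hρ : Function.Injective ρ) (hdeg : n ∣ ∑ i, l i) (μ : ℕ) {j : ℤ}
    (hj : j ≤ -(t n l μ : ℤ)) :
    regularMonomial n ρ l μ j ∈ regularFunctions (U (x n ρ l) ((0 : k) : OnePoint k)) := by
  intro P hP
  have hn0 : n ≠ 0 := by rintro rfl; simp at hn
  obtain ⟨a, ha⟩ := exists_mem_fiber hn0 P
  induction a using OnePoint.rec with
  | infty => exact regularMonomial_mem_of_infinite hn hdeg ha μ hj
  | coe c =>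
    refine regularMonomial_mem_of_finite hn hρ ha μ (Or.inr ?_)
    rintro rfl
    exact hP ha

theorem regularMonomial_mem_overlap [IsAlgClosed k] (hn : (n : k) ≠ 0)
    (hρ : Function.Injective ρ) (μ : ℕ) (j : ℤ) :
    regularMonomial n ρ l μ j ∈ regularFunctions (overlap (k := k) (x n ρ l)) := by
  intro P hP
  have hn0 : n ≠ 0 := by rintro rfl; simp at hn
  obtain ⟨a, ha⟩ := exists_mem_fiber hn0 P
  induction a using OnePoint.rec with
  | infty => exact absurd ha hP.2
  | coe c =>
    refine regularMonomial_mem_of_finite hn hρ ha μ (Or.inr ?_)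
    rintro rfl
    exact hP.1 ha

theorem hFun_eq (μ ν : ℕ) : hFun n ρ l μ ν = regularMonomial n ρ l μ (-(ν : ℤ)) := by
  rw [hFun, regularMonomial, algebraMap_X_zpow_div_g, aeval_X, zpow_neg, zpow_natCast,
    zpow_natCast]
  field_simp

theorem omega_eq {μ ν : ℕ} (hν : 1 ≤ ν) : omega n ρ l μ ν =
    (algebraMap (RatFunc k) (FunctionField n ρ l)
      (RatFunc.X ^ ((ν : ℤ) - 1) * algebraMap k[X] (RatFunc k) (g n ρ l μ)) *
        y n ρ l ^ (-(μ : ℤ))) • D k (FunctionField n ρ l) (x n ρ l) := by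
  rw [omega, map_mul, map_zpow₀, ← aeval_x, ← x_eq, zpow_neg, zpow_natCast, div_eq_mul_inv]
  congr 3
  rw [← zpow_natCast]
  congr 1
  omega

end Membership

/-! ### The differentials `ω_{μ,ν}` are holomorphic. -/

section Holomorphy

open LaurentSeries

variable {k : Type*} [Field k] {r : ℕ} {n : ℕ} {ρ : Fin r → k} {l : Fin r → ℕ}
  [hirr : Fact (Irreducible (equation n ρ l))]

theorem exists_bezout (hn : (n : k) ≠ 0) (c : k) :
    ∃ α β : ℤ, α * lamAt n ρ l c + β * eAt n ρ l c = 1 := by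
  have hn0 : 0 < n := Nat.pos_of_ne_zero (by rintro rfl; simp at hn)
  have h := Nat.coprime_div_gcd_div_gcd
    (Nat.gcd_pos_of_pos_left ((f ρ l).rootMultiplicity c) hn0)
  have h2 : IsCoprime (lamAt n ρ l c : ℤ) (eAt n ρ l c : ℤ) :=
    Nat.isCoprime_iff_coprime.mpr h.symm
  exact h2

/-- The differential of the local uniformizer `y ^ α (x - c) ^ β`, where `α λ + β e = 1`. -/
theorem D_uniformizer (hn : (n : k) ≠ 0) {c : k} {f₁ : k[X]}
    (hf₁ : f ρ l = (X - C c) ^ (f ρ l).rootMultiplicity c * f₁) {α β : ℤ}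
    (hαβ : α * lamAt n ρ l c + β * eAt n ρ l c = 1) :
    (aeval (x n ρ l) (C ((eAt n ρ l c : k) * n) * f₁) *
        (x n ρ l - algebraMap k (FunctionField n ρ l) c)) •
      D k (FunctionField n ρ l)
        (y n ρ l ^ α * (x n ρ l - algebraMap k (FunctionField n ρ l) c) ^ β) =
    (y n ρ l ^ α * (x n ρ l - algebraMap k (FunctionField n ρ l) c) ^ β *
      aeval (x n ρ l) (C (n : k) * f₁ + C ((eAt n ρ l c : k) * α) * (X - C c) * derivative f₁)) •
      D k (FunctionField n ρ l) (x n ρ l) := by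
  have hn0 : n ≠ 0 := by rintro rfl; simp at hn
  set z := x n ρ l - algebraMap k (FunctionField n ρ l) c with hz
  set e := eAt n ρ l c
  set lam := lamAt n ρ l c
  set mc := (f ρ l).rootMultiplicity c with hmc
  have hy0 : y n ρ l ≠ 0 := y_ne_zero hn0
  have hzeq : z = aeval (x n ρ l) (X - C c) := by rw [map_sub, aeval_X, aeval_C]
  have hz0 : z ≠ 0 := by rw [hzeq]; exact aeval_x_ne_zero (X_sub_C_ne_zero c)
  have hnF : (n : FunctionField n ρ l) ≠ 0 := by
    rw [← map_natCast (algebraMap k (FunctionField n ρ l))]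
    exact (_root_.map_ne_zero _).mpr hn
  have hf₁0 : aeval (x n ρ l) f₁ ≠ 0 := aeval_x_ne_zero fun h => f_ne_zero (ρ := ρ) (l := l)
    (by rw [hf₁, h, mul_zero])
  have hDz : D k (FunctionField n ρ l) z = D k (FunctionField n ρ l) (x n ρ l) := by
    rw [hz, map_sub, Derivation.map_algebraMap, sub_zero]
  have hf' : aeval (x n ρ l) (derivative (f ρ l)) * z =
      (mc : FunctionField n ρ l) * aeval (x n ρ l) (f ρ l) +
        z ^ mc * z * aeval (x n ρ l) (derivative f₁) := by
    rw [hf₁, Polynomial.derivative_mul, derivative_X_sub_C_pow]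
    simp only [map_add, map_mul, map_pow, map_natCast, ← hzeq]
    rcases Nat.eq_zero_or_pos mc with h0 | h0
    · rw [h0]; simp
      ring
    · obtain ⟨j, hj⟩ : ∃ j, mc = j + 1 := ⟨mc - 1, by omega⟩
      rw [hj]
      simp only [Nat.add_sub_cancel, pow_succ]
      ring
  have hfx : aeval (x n ρ l) (f ρ l) = z ^ mc * aeval (x n ρ l) f₁ := by
    conv_lhs => rw [hf₁, map_mul, map_pow, ← hzeq]
  have hyn : y n ρ l ^ (n - 1) * y n ρ l = aeval (x n ρ l) (f ρ l) := by
    rw [← y_pow, ← pow_succ, Nat.sub_add_cancel (Nat.pos_of_ne_zero hn0)]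
  -- The logarithmic derivative `dy / y = f' / (n f) dx`, cleared of denominators by `n (x - c) f₁`.
  have hDy : (y n ρ l)⁻¹ * (aeval (x n ρ l) (derivative (f ρ l)) /
      (n * y n ρ l ^ (n - 1))) * (n * z * aeval (x n ρ l) f₁) =
      mc * aeval (x n ρ l) f₁ + z * aeval (x n ρ l) (derivative f₁) := by
    have h1 : (y n ρ l)⁻¹ * (aeval (x n ρ l) (derivative (f ρ l)) / (n * y n ρ l ^ (n - 1))) =
        aeval (x n ρ l) (derivative (f ρ l)) / (n * aeval (x n ρ l) (f ρ l)) := by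
      rw [← hyn]; field_simp
    have hzm : z ^ mc ≠ 0 := pow_ne_zero _ hz0
    rw [h1, hfx, div_mul_eq_mul_div, div_eq_iff (mul_ne_zero hnF (mul_ne_zero hzm hf₁0))]
    linear_combination (n : FunctionField n ρ l) * aeval (x n ρ l) f₁ * hf' +
      (n : FunctionField n ρ l) * aeval (x n ρ l) f₁ * mc * hfx
  have hcast : (α : FunctionField n ρ l) * lam + β * e = 1 := by
    exact_mod_cast congrArg (Int.cast : ℤ → FunctionField n ρ l) hαβ
  have hem : (e : FunctionField n ρ l) * mc = lam * n := by
    exact_mod_cast congrArg (Nat.cast : ℕ → FunctionField n ρ l)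
      (eAt_mul_rootMultiplicity (n := n) (ρ := ρ) (l := l) c)
  rw [Derivation.leibniz, Derivation.leibniz_zpow, Derivation.leibniz_zpow, D_y hn, hDz,
    ← Int.cast_smul_eq_zsmul (FunctionField n ρ l), ← Int.cast_smul_eq_zsmul (FunctionField n ρ l)]
  simp only [smul_smul, ← add_smul]
  congr 1
  simp only [map_add, map_mul, map_natCast, map_intCast, ← hzeq]
  rw [zpow_sub_one₀ hy0, zpow_sub_one₀ hz0]
  have hzz : z * z⁻¹ = 1 := mul_inv_cancel₀ hz0
  -- This is `du / u = α dy / y + β dz / z` times `e n f₁ z`; the terms without `f₁'` collapse to `n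
  -- f₁` by `e m = λ n` and `α λ + β e = 1`.
  linear_combination (y n ρ l ^ α * z ^ β * α * e) * hDy +
    (y n ρ l ^ α * z ^ β * β * e * n * aeval (x n ρ l) f₁) * hzz +
    (y n ρ l ^ α * z ^ β * α * aeval (x n ρ l) f₁) * hem +
    (y n ρ l ^ α * z ^ β * n * aeval (x n ρ l) f₁) * hcast

theorem order_map_X_sub_C_zpow {c : k} {ψ : FunctionField n ρ l →ₐ[k] LaurentSeries k}
    (h : FiniteGerm c ψ) (β : ℤ) :
    (ψ (algebraMap (RatFunc k) _ (algebraMap k[X] (RatFunc k) (X - C c) ^ β))).order =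
      β * eAt n ρ l c := by
  rw [map_zpow₀, ← aeval_x, map_sub, aeval_X, aeval_C, map_zpow₀, h.map_x_sub, order_zpow,
    HahnSeries.order_single one_ne_zero]

/-- The stalk is spanned by products `a db` with `a`, `b` regular, so `dx` is rewritten through the
local parameter `u = y ^ α (x - c) ^ β` as a regular factor times `((x - c) / u) du`. -/
theorem omega_mem_of_finite [IsAlgClosed k] (hn : (n : k) ≠ 0) (hρ : Function.Injective ρ) {c : k}
    {P : Place k (FunctionField n ρ l)} (hP : P ∈ fiber (x n ρ l) (c : OnePoint k)) {μ ν : ℕ}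
    (hν : 1 ≤ ν) : omega n ρ l μ ν ∈ differentialStalk P := by
  have hn0 : n ≠ 0 := by rintro rfl; simp at hn
  obtain ⟨ψ, hψ⟩ := exists_finiteGerm (n := n) (ρ := ρ) (l := l) hn c
  obtain ⟨α, β, hαβ⟩ := exists_bezout (ρ := ρ) (l := l) hn c
  obtain ⟨f₁, hf₁, hnd⟩ := exists_eq_pow_rootMultiplicity_mul_and_not_dvd (f ρ l) f_ne_zero c
  have hD := D_uniformizer hn hf₁ hαβ
  set p := C (n : k) * f₁ + C ((eAt n ρ l c : k) * α) * (X - C c) * derivative f₁ with hp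
  -- The value at `c` is `n f₁(c)`, so the denominator `p(x)` is a unit at `P`.
  have hpc : p.eval c ≠ 0 := by
    rw [hp]
    simpa using ⟨hn, by simpa [dvd_iff_isRoot] using hnd⟩
  have hp0 : p ≠ 0 := by rintro h; rw [h] at hpc; simp at hpc
  have hy0 : y n ρ l ≠ 0 := y_ne_zero hn0
  set Z : RatFunc k := algebraMap k[X] (RatFunc k) (X - C c) with hZ
  have hZ0 : Z ≠ 0 := by
    exact RatFunc.algebraMap_ne_zero (X_sub_C_ne_zero c)
  have hzeq : x n ρ l - algebraMap k (FunctionField n ρ l) c = algebraMap (RatFunc k) _ Z := by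
    rw [hZ, ← aeval_x, map_sub, aeval_X, aeval_C]
  have hz0 : algebraMap (RatFunc k) (FunctionField n ρ l) Z ≠ 0 := (_root_.map_ne_zero _).mpr hZ0
  set u := algebraMap (RatFunc k) (FunctionField n ρ l) (Z ^ β) * y n ρ l ^ α with hu
  have hu' : y n ρ l ^ α * (x n ρ l - algebraMap k (FunctionField n ρ l) c) ^ β = u := by
    rw [hzeq, hu, map_zpow₀, mul_comm]
  have humem : u ∈ P.ring := by
    refine hψ.monomial_mem hn hP ?_
    rw [order_monomial hn0 ψ (zpow_ne_zero _ hZ0), order_map_X_sub_C_zpow hψ, hψ.order_y]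
    linarith
  set A : RatFunc k := RatFunc.X ^ ((ν : ℤ) - 1) * algebraMap k[X] (RatFunc k) (g n ρ l μ) with hA
  have hA0 : A ≠ 0 := mul_ne_zero (zpow_ne_zero _ RatFunc.X_ne_zero) (by simpa using g_ne_zero μ)
  have hcoef : algebraMap (RatFunc k) (FunctionField n ρ l) (A * Z ^ (1 - β)) *
      y n ρ l ^ (-(μ : ℤ) - α) ∈ P.ring := by
    refine hψ.monomial_mem hn hP ?_
    rw [order_monomial hn0 ψ (mul_ne_zero hA0 (zpow_ne_zero _ hZ0)), map_mul, map_mul,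
      HahnSeries.order_mul ((_root_.map_ne_zero ψ).mpr ((_root_.map_ne_zero _).mpr hA0))
        ((_root_.map_ne_zero ψ).mpr ((_root_.map_ne_zero _).mpr (zpow_ne_zero _ hZ0))),
      order_map_X_sub_C_zpow hψ, hψ.order_y, hA, map_mul, map_mul,
      HahnSeries.order_mul
        ((_root_.map_ne_zero ψ).mpr ((_root_.map_ne_zero _).mpr (zpow_ne_zero _ RatFunc.X_ne_zero)))
        ((_root_.map_ne_zero ψ).mpr ((_root_.map_ne_zero _).mpr (by simpa using g_ne_zero μ))),
      ← aeval_x, hψ.order_aeval hn (g_ne_zero μ), rootMultiplicity_g hρ, map_zpow₀, map_zpow₀,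
      ← RatFunc.algebraMap_X, ← aeval_x, order_zpow, hψ.order_aeval hn X_ne_zero]
    have h1 : 0 ≤ ((ν : ℤ) - 1) * ((eAt n ρ l c : ℤ) * ((X : k[X]).rootMultiplicity c : ℕ)) :=
      mul_nonneg (by omega) (by positivity)
    -- Since `α λ + β e = 1`, the order is at least `e - 1 - (μ λ mod e) ≥ 0`.
    have h4 := Nat.div_add_mod (μ * lamAt n ρ l c) (eAt n ρ l c)
    have h5 := Nat.mod_lt (μ * lamAt n ρ l c) (eAt_pos (ρ := ρ) (l := l) hn c)
    zify at h4 h5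
    push_cast
    linarith
  have hDx : D k (FunctionField n ρ l) (x n ρ l) =
      (u⁻¹ * (aeval (x n ρ l) p)⁻¹ * aeval (x n ρ l) (C ((eAt n ρ l c : k) * n) * f₁) *
        algebraMap (RatFunc k) _ Z) • D k (FunctionField n ρ l) u := by
    have hu0 : u ≠ 0 := mul_ne_zero ((_root_.map_ne_zero _).mpr (zpow_ne_zero _ hZ0))
      (zpow_ne_zero _ hy0)
    have hpx0 : aeval (x n ρ l) p ≠ 0 := aeval_x_ne_zero hp0
    rw [hu', hzeq] at hD
    rw [mul_assoc, mul_smul, hD, smul_smul]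
    have : u⁻¹ * (aeval (x n ρ l) p)⁻¹ * (u * aeval (x n ρ l) p) = 1 := by field_simp
    rw [this, one_smul]
  rw [omega_eq hν, hDx, smul_smul]
  refine smul_D_mem_differentialStalk ?_ humem
  have hz := mem_fiber_coe.mp hP
  have e1 : algebraMap (RatFunc k) (FunctionField n ρ l) A * y n ρ l ^ (-(μ : ℤ)) *
      (u⁻¹ * (aeval (x n ρ l) p)⁻¹ * aeval (x n ρ l) (C ((eAt n ρ l c : k) * n) * f₁) *
        algebraMap (RatFunc k) _ Z) =
      algebraMap (RatFunc k) (FunctionField n ρ l) (A * Z ^ (1 - β)) *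
        y n ρ l ^ (-(μ : ℤ) - α) * (aeval (x n ρ l) p)⁻¹ *
        aeval (x n ρ l) (C ((eAt n ρ l c : k) * n) * f₁) := by
    rw [hu, map_mul _ A, map_zpow₀, map_zpow₀, zpow_sub₀ hy0, zpow_sub₀ hz0, zpow_one]
    field_simp
  rw [e1]
  exact mul_mem (mul_mem hcoef (P.inv_aeval_mem hz hpc))
    (P.aeval_mem (mem_ring_of_mem_fiber hP) _)

/-- Relative to `d(1 / x)` the coefficient has order `t^{(μ)} - ν - 1`, which explains the bound `ν
< t^{(μ)}`. -/
theorem omega_mem_of_infinite [IsAlgClosed k] (hn : (n : k) ≠ 0) (hdeg : n ∣ ∑ i, l i)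
    {P : Place k (FunctionField n ρ l)} (hP : x n ρ l ∉ P.ring) {μ ν : ℕ}
    (hν : 1 ≤ ν) (hνt : ν < t n l μ) : omega n ρ l μ ν ∈ differentialStalk P := by
  have hn0 : n ≠ 0 := by rintro rfl; simp at hn
  obtain ⟨ψ, hψ, -⟩ := exists_infiniteGerm (n := n) (ρ := ρ) (l := l) hn hdeg
  rw [omega_eq hν, D_x_eq, smul_smul]
  refine smul_D_mem_differentialStalk ?_ (P.inv_mem hP)
  have e1 : algebraMap (RatFunc k) (FunctionField n ρ l)
      (RatFunc.X ^ ((ν : ℤ) - 1) * algebraMap k[X] (RatFunc k) (g n ρ l μ)) *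
        y n ρ l ^ (-(μ : ℤ)) * -(x n ρ l ^ 2) =
      -(algebraMap (RatFunc k) (FunctionField n ρ l)
        (algebraMap k[X] (RatFunc k) (X ^ (ν + 1) * g n ρ l μ)) * y n ρ l ^ (-(μ : ℤ))) := by
    obtain ⟨j, rfl⟩ := Nat.exists_eq_add_of_le hν
    rw [show (((1 + j : ℕ) : ℤ) - 1) = (j : ℤ) by push_cast; ring]
    simp only [map_mul, map_pow, zpow_natCast, RatFunc.algebraMap_X, x_eq]
    ring
  rw [e1]
  have hq : X ^ (ν + 1) * g n ρ l μ ≠ 0 := mul_ne_zero (pow_ne_zero _ X_ne_zero) (g_ne_zero μ)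
  refine neg_mem (hψ.monomial_mem hn0 hP ?_)
  rw [order_monomial hn0 ψ (RatFunc.algebraMap_ne_zero hq), ← aeval_x, hψ.order_aeval hq, hψ.order_y,
    natDegree_mul (pow_ne_zero _ X_ne_zero) (g_ne_zero μ), natDegree_X_pow, natDegree_g]
  have := degree_identity (l := l) hn0 hdeg μ
  zify at this hνt
  push_cast
  linarith

theorem omega_mem [IsAlgClosed k] (hn : (n : k) ≠ 0) (hρ : Function.Injective ρ)
    (hdeg : n ∣ ∑ i, l i) {μ ν : ℕ} (hν : 1 ≤ ν) (hνt : ν < t n l μ) :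
    omega n ρ l μ ν ∈ holomorphicDifferentials k (FunctionField n ρ l) := by
  have hn0 : n ≠ 0 := by rintro rfl; simp at hn
  refine (Submodule.mem_iInf _).mpr fun P => ?_
  obtain ⟨a, ha⟩ := exists_mem_fiber hn0 P
  induction a using OnePoint.rec with
  | infty => exact omega_mem_of_infinite hn hdeg ha hν hνt
  | coe c => exact omega_mem_of_finite hn hρ ha hν

end Holomorphy

/-! ### The residue pairing, duality and spanning. -/

section Duality

open LaurentSeries

variable {k : Type*} [Field k] {r : ℕ} {n : ℕ} {ρ : Fin r → k} {l : Fin r → ℕ}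

/-- A rational function with poles at most at `0` is a Laurent polynomial. -/
theorem exists_eq_div_X_pow [IsAlgClosed k] {b : RatFunc k} (hb : ∀ c ≠ 0, b.denom.eval c ≠ 0) :
    ∃ (p : k[X]) (N : ℕ), b = algebraMap k[X] (RatFunc k) p / RatFunc.X ^ N := by
  have h1 : b.denom = X ^ b.denom.natDegree := by
    have hs := (IsAlgClosed.splits b.denom).eq_prod_roots_of_monic (RatFunc.monic_denom b)
    have hr : b.denom.roots = Multiset.replicate (Multiset.card b.denom.roots) 0 := by
      rw [Multiset.eq_replicate_card]
      intro c hc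
      by_contra hc0
      exact hb c hc0 ((mem_roots (RatFunc.denom_ne_zero b)).mp hc)
    have hdeg := (IsAlgClosed.splits b.denom).natDegree_eq_card_roots
    rw [hr] at hs
    rw [hdeg]
    conv_lhs => rw [hs]
    simp
  refine ⟨b.num, b.denom.natDegree, ?_⟩
  conv_lhs => rw [← RatFunc.num_div_denom b, h1]
  rw [map_pow, RatFunc.algebraMap_X]

/-- A rational function without finite poles is a polynomial. -/
theorem exists_eq_algebraMap [IsAlgClosed k] {b : RatFunc k} (hb : ∀ c, b.denom.eval c ≠ 0) :
    ∃ p : k[X], b = algebraMap k[X] (RatFunc k) p := by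
  have h1 : b.denom = 1 := by
    rw [← (RatFunc.monic_denom b).natDegree_eq_zero]
    by_contra h0
    obtain ⟨c, hc⟩ := IsAlgClosed.exists_root b.denom fun h => h0 (natDegree_eq_of_degree_eq_some h)
    exact hb c hc
  refine ⟨b.num, ?_⟩
  conv_lhs => rw [← RatFunc.num_div_denom b, h1, map_one, div_one]

variable [hirr : Fact (Irreducible (equation n ρ l))] [IsAlgClosed k]

/-- The bilinear form `-(1 / n) ∑ Res_P (h η)`, summed over the points above `∞`. -/
def residuePairing (ψ : FunctionField n ρ l →ₐ[k] LaurentSeries k) :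
    Ω[FunctionField n ρ l⁄k] →ₗ[k] FunctionField n ρ l →ₗ[k] k :=
  LinearMap.mk₂ k (fun η h => -(1 / (n : k)) * ∑ ζ ∈ nthRootsFinset n (1 : k),
      (diffExpand (ψ.comp (twist n ρ l ζ)) (h • η)).coeff (-1))
    (fun η η' h => by
      simp only [smul_add, map_add, HahnSeries.coeff_add, Finset.sum_add_distrib, mul_add])
    (fun c η h => by
      simp only [smul_comm h c η, map_smul, HahnSeries.coeff_smul, ← Finset.smul_sum,
        mul_smul_comm])
    (fun η h h' => by
      simp only [add_smul, map_add, HahnSeries.coeff_add, Finset.sum_add_distrib, mul_add])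
    (fun c η h => by
      simp only [smul_assoc, map_smul, HahnSeries.coeff_smul, ← Finset.smul_sum, mul_smul_comm])

theorem residuePairing_apply (ψ : FunctionField n ρ l →ₐ[k] LaurentSeries k)
    (η : Ω[FunctionField n ρ l⁄k]) (h : FunctionField n ρ l) :
    residuePairing ψ η h = -(1 / (n : k)) * ∑ ζ ∈ nthRootsFinset n (1 : k),
      (diffExpand (ψ.comp (twist n ρ l ζ)) (h • η)).coeff (-1) := rfl

/-- The automorphism scales the monomial by `ζ ^ i`, so a character sum appears; `dx = -T⁻² dT`
moves the coefficient at `-1` to the one at `1` and changes the sign. -/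
theorem sum_coeff_monomial (hn : (n : k) ≠ 0)
    {ψ : FunctionField n ρ l →ₐ[k] LaurentSeries k} (hψ : InfiniteGerm ψ) (a : RatFunc k) (i : ℤ) :
    ∑ ζ ∈ nthRootsFinset n (1 : k), (diffExpand (ψ.comp (twist n ρ l ζ))
      ((algebraMap (RatFunc k) (FunctionField n ρ l) a * y n ρ l ^ i) •
        D k (FunctionField n ρ l) (x n ρ l))).coeff (-1) =
      if (n : ℤ) ∣ i then -(n : k) * (ψ (algebraMap (RatFunc k) _ a * y n ρ l ^ i)).coeff 1
      else 0 := by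
  have hn0 : 0 < n := Nat.pos_of_ne_zero (by rintro rfl; simp at hn)
  have h1 : ∀ ζ ∈ nthRootsFinset n (1 : k), (diffExpand (ψ.comp (twist n ρ l ζ))
      ((algebraMap (RatFunc k) (FunctionField n ρ l) a * y n ρ l ^ i) •
        D k (FunctionField n ρ l) (x n ρ l))).coeff (-1) =
      ζ ^ i * -(ψ (algebraMap (RatFunc k) _ a * y n ρ l ^ i)).coeff 1 := by
    intro ζ hζ
    have hζ' := (Polynomial.mem_nthRootsFinset hn0 1).mp hζ
    rw [diffExpand_smul, (hψ.twist hn0.ne' hζ').diffExpand_D_x, AlgHom.comp_apply, map_mul,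
      twist_ratFunc, map_zpow₀, twist_y hζ', mul_zpow, ← map_zpow₀, mul_left_comm,
      map_algebraMap_mul, mul_assoc, HahnSeries.C_mul_eq_smul, HahnSeries.coeff_smul, smul_eq_mul,
      mul_comm (ψ _), coeff_single_mul_sub]
    norm_num
  rw [Finset.sum_congr rfl h1, ← Finset.sum_mul, sum_rootsOfUnity_zpow hn]
  split_ifs <;> ring

/-- The pairing vanishes on functions that are regular above `∞`. -/
theorem residuePairing_eq_zero_of_U_zero
    {ψ : FunctionField n ρ l →ₐ[k] LaurentSeries k} (hψ : InfiniteGerm ψ)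
    {η : Ω[FunctionField n ρ l⁄k]} (hη : η ∈ holomorphicDifferentials k (FunctionField n ρ l))
    {h : FunctionField n ρ l}
    (hh : h ∈ regularFunctions (U (x n ρ l) ((0 : k) : OnePoint k))) :
    residuePairing ψ η h = 0 := by
  rw [residuePairing_apply, Finset.sum_eq_zero, mul_zero]
  intro ζ hζ
  -- The points above `∞` lie in `U_0`, so `h η` is regular at them.
  have hP : hψ.place ζ ∈ U (x n ρ l) ((0 : k) : OnePoint k) := fun hc =>
    hψ.place_mem_fiber ζ (mem_ring_of_mem_fiber hc)
  exact coeff_eq_zero_of_mem_integers (diffExpand_mem_integers (h := hψ.notMem_integers ζ)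
    (smul_mem_differentialStalk (hh _ hP) ((Submodule.mem_iInf _).mp hη _))) (by norm_num)

/-- The pairing vanishes on functions that are regular at all finite points. -/
theorem residuePairing_eq_zero_of_U_infty (hn : (n : k) ≠ 0) (hρ : Function.Injective ρ)
    {ψ : FunctionField n ρ l →ₐ[k] LaurentSeries k} (hψ : InfiniteGerm ψ)
    {η : Ω[FunctionField n ρ l⁄k]} (hη : η ∈ holomorphicDifferentials k (FunctionField n ρ l))
    {h : FunctionField n ρ l}
    (hh : h ∈ regularFunctions (U (x n ρ l) (OnePoint.infty : OnePoint k))) :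
    residuePairing ψ η h = 0 := by
  have hn0 : 0 < n := Nat.pos_of_ne_zero (by rintro rfl; simp at hn)
  obtain ⟨G, hG⟩ := exists_eq_smul_D_x hn (h • η)
  obtain ⟨a, ha⟩ := exists_sum_inv_pow hn0.ne' G
  have hreg : ∀ c : k, ∀ P ∈ fiber (k := k) (x n ρ l) (c : OnePoint k), (∑ j ∈ Finset.range n,
      algebraMap (RatFunc k) (FunctionField n ρ l) (a j) * (y n ρ l)⁻¹ ^ j) •
        D k _ (x n ρ l) ∈ differentialStalk P := fun c P hP => by
    rw [← ha, ← hG]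
    refine smul_mem_differentialStalk (hh P fun hc => ?_) ((Submodule.mem_iInf _).mp hη _)
    exact hc (mem_ring_of_mem_fiber hP)
  -- As `g_0 = 1`, the `y ^ 0` component of `h η` is a polynomial times `dx`. The other components
  -- cancel in the sum over `ζ`, and `p(T⁻¹)` has no term in `T`.
  obtain ⟨p, hp⟩ := exists_eq_algebraMap fun c =>
    denom_eval_ne_zero_of_differential hn hρ a (hreg c) hn0
  rw [g_zero, map_one, div_one] at hp
  rw [residuePairing_apply, hG, ha]
  simp_rw [Finset.sum_smul, map_sum, HahnSeries.coeff_sum]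
  rw [Finset.sum_comm, Finset.sum_eq_zero, mul_zero]
  intro j hj
  have hj' := Finset.mem_range.mp hj
  have hy : (y n ρ l)⁻¹ ^ j = y n ρ l ^ (-(j : ℤ)) := by
    rw [zpow_neg, zpow_natCast, inv_pow]
  rw [hy, sum_coeff_monomial hn hψ]
  split_ifs with hd
  · have hj0 : j = 0 := by
      rw [Int.dvd_neg] at hd
      exact Nat.eq_zero_of_dvd_of_lt (Int.natCast_dvd_natCast.mp hd) hj'
    subst hj0
    rw [Nat.cast_zero, neg_zero, zpow_zero, mul_one, hp, ← aeval_x, algHom_aeval_x, hψ.map_x,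
      aeval_eq_sum_range, HahnSeries.coeff_sum, Finset.sum_eq_zero, mul_zero]
    intro i _
    rw [Algebra.smul_def, algebraMap_eq_C, HahnSeries.C_mul_eq_smul, HahnSeries.coeff_smul,
      HahnSeries.single_pow, one_pow, HahnSeries.coeff_single_of_ne (by simp; omega), smul_zero]
  · rfl

/-- The product is `x ^ (ν - ν' - 1) (g_μ / g_μ') y ^ (μ' - μ) dx`. As `|μ' - μ| < n`, only `μ = μ'`
survives the character sum, and then `T ^ (ν' + 1 - ν)` has a coefficient at `1` only for `ν = ν'`.
-/
theorem residuePairing_omega_hFun (hn : (n : k) ≠ 0)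
    {ψ : FunctionField n ρ l →ₐ[k] LaurentSeries k} (hψ : InfiniteGerm ψ) (i j : Index n l) :
    residuePairing ψ (omega n ρ l i.1.1 i.1.2) (hFun n ρ l j.1.1 j.1.2) =
      if i = j then 1 else 0 := by
  have hn0 : 0 < n := Nat.pos_of_ne_zero (by rintro rfl; simp at hn)
  obtain ⟨⟨μ, ν⟩, ⟨hμ, hμn⟩, hν, hνt⟩ := i
  obtain ⟨⟨μ', ν'⟩, ⟨hμ', hμn'⟩, hν', hνt'⟩ := j
  simp only at hμ hμn hν hνt hμ' hμn' hν' hνt'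
  have hy0 : y n ρ l ≠ 0 := y_ne_zero hn0.ne'
  have e1 : hFun n ρ l μ' ν' • omega n ρ l μ ν =
      (algebraMap (RatFunc k) (FunctionField n ρ l)
        (RatFunc.X ^ (-(ν' : ℤ)) / algebraMap k[X] (RatFunc k) (g n ρ l μ') *
          (RatFunc.X ^ ((ν : ℤ) - 1) * algebraMap k[X] (RatFunc k) (g n ρ l μ))) *
        y n ρ l ^ ((μ' : ℤ) - μ)) • D k (FunctionField n ρ l) (x n ρ l) := by
    rw [hFun_eq, regularMonomial, omega_eq hν, smul_smul, sub_eq_add_neg (μ' : ℤ), zpow_add₀ hy0,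
      map_mul (algebraMap (RatFunc k) (FunctionField n ρ l)) (_ / _)]
    congr 1
    ring
  rw [residuePairing_apply, e1, sum_coeff_monomial hn hψ]
  by_cases hμμ : μ = μ'
  · subst hμμ
    rw [sub_self, if_pos (dvd_zero _), zpow_zero, mul_one]
    have hg := RatFunc.algebraMap_ne_zero (g_ne_zero (n := n) (ρ := ρ) (l := l) μ)
    have e2 : RatFunc.X ^ (-(ν' : ℤ)) / algebraMap k[X] (RatFunc k) (g n ρ l μ) *
        (RatFunc.X ^ ((ν : ℤ) - 1) * algebraMap k[X] (RatFunc k) (g n ρ l μ)) =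
        RatFunc.X ^ (-(ν' : ℤ) + (ν - 1)) := by
      rw [zpow_add₀ RatFunc.X_ne_zero]
      field_simp
    have e3 : (HahnSeries.single (-1 : ℤ) (1 : k)) ^ (-(ν' : ℤ) + (ν - 1)) =
        HahnSeries.single ((ν' : ℤ) + 1 - ν) (1 : k) := by
      have : HahnSeries.single (-1 : ℤ) (1 : k) = (HahnSeries.single (1 : ℤ) (1 : k)) ^ (-1 : ℤ) :=
        RatFunc.single_zpow _
      rw [this, ← zpow_mul, ← RatFunc.single_zpow]
      congr 2
      ring
    rw [e2, map_zpow₀, ← x_eq, map_zpow₀, hψ.map_x, e3]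
    by_cases hνν : ν = ν'
    · subst hνν
      rw [show (ν : ℤ) + 1 - ν = 1 by ring, HahnSeries.coeff_single_same, if_pos rfl]
      field_simp
    · rw [HahnSeries.coeff_single_of_ne (by omega), if_neg (by simpa using hνν), mul_zero, mul_zero]
  · rw [if_neg, if_neg, mul_zero]
    · simpa using fun h => absurd h hμμ
    · intro hd
      have := Int.eq_zero_of_abs_lt_dvd hd (by rw [abs_lt]; omega)
      omega

/-- The residue pairing on `H⁰(X, Ω_X) × H¹(X, 𝒪_X)`. -/
theorem exists_pairing (hn : (n : k) ≠ 0) (hρ : Function.Injective ρ)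
    {ψ : FunctionField n ρ l →ₐ[k] LaurentSeries k} (hψ : InfiniteGerm ψ) :
    ∃ pairing : holomorphicDifferentials k (FunctionField n ρ l) →ₗ[k]
      CechH1 (k := k) (x n ρ l) →ₗ[k] k,
      ∀ (ω : holomorphicDifferentials k (FunctionField n ρ l))
        (h : regularFunctions (overlap (k := k) (x n ρ l))),
        pairing ω (cechClass (x n ρ l) h) = residuePairing ψ ω h := by
  let B : regularFunctions (overlap (k := k) (x n ρ l)) →ₗ[k]
      holomorphicDifferentials k (FunctionField n ρ l) →ₗ[k] k :=
    ((residuePairing ψ).compl₁₂ (Submodule.subtype _) (Submodule.subtype _)).flip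
  have hB : cechCoboundaries (U (x n ρ l) ((0 : k) : OnePoint k))
      (U (x n ρ l) (OnePoint.infty : OnePoint k)) ≤ LinearMap.ker B := by
    rintro h ⟨h₀, hh₀, h₁, hh₁, heq⟩
    rw [LinearMap.mem_ker]
    ext ω
    change residuePairing ψ ω h = 0
    rw [heq, map_sub, residuePairing_eq_zero_of_U_zero hψ ω.2 hh₀,
      residuePairing_eq_zero_of_U_infty hn hρ hψ ω.2 hh₁, sub_zero]
  exact ⟨(Submodule.liftQ _ B hB).flip, fun ω h => rfl⟩

/-- The differentials `ω_{μ,ν}` span `H⁰(X, Ω_X)`. -/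
theorem mem_span_omega (hn : (n : k) ≠ 0) (hρ : Function.Injective ρ) (hdeg : n ∣ ∑ i, l i)
    {η : Ω[FunctionField n ρ l⁄k]} (hη : η ∈ holomorphicDifferentials k (FunctionField n ρ l)) :
    η ∈ Submodule.span k (Set.range fun i : Index n l => omega n ρ l i.1.1 i.1.2) := by
  have hn0 : n ≠ 0 := by rintro rfl; simp at hn
  obtain ⟨ψ, hψ, -⟩ := exists_infiniteGerm (n := n) (ρ := ρ) (l := l) hn hdeg
  obtain ⟨G, rfl⟩ := exists_eq_smul_D_x hn η
  obtain ⟨a, rfl⟩ := exists_sum_inv_pow hn0 G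
  have hpow : ∀ j : ℕ, y n ρ l ^ ((-1 : ℤ) * j) = (y n ρ l)⁻¹ ^ j := fun j => by
    rw [neg_one_mul, zpow_neg, zpow_natCast, inv_pow]
  rw [Finset.sum_smul]
  refine Submodule.sum_mem _ fun j hj => ?_
  have hj' := Finset.mem_range.mp hj
  obtain ⟨p, hp⟩ := exists_eq_algebraMap fun c =>
    denom_eval_ne_zero_of_differential hn hρ (c := c) a
      (fun P _ => (Submodule.mem_iInf _).mp hη P) hj'
  have hg := RatFunc.algebraMap_ne_zero (g_ne_zero (n := n) (ρ := ρ) (l := l) j)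
  have haj : a j = algebraMap k[X] (RatFunc k) (p * g n ρ l j) := by
    rw [map_mul, ← hp, div_mul_cancel₀ _ hg]
  rcases eq_or_ne p 0 with rfl | hp0
  · rw [haj, zero_mul, map_zero, map_zero, zero_mul, zero_smul]; exact zero_mem _
  have hpg := mul_ne_zero hp0 (g_ne_zero (n := n) (ρ := ρ) (l := l) j)
  have h1 := mem_integers_component hn ψ (diffExpand ψ (D k _ (x n ρ l))) (Or.inr rfl) a
    (fun ζ hζ => by
      have h2 := hψ.twist hn0 hζ
      have h3 := diffExpand_mem_integers (h := hψ.notMem_integers ζ)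
        ((Submodule.mem_iInf _).mp hη _)
      rw [diffExpand_smul, h2.diffExpand_D_x] at h3
      rw [hψ.diffExpand_D_x]
      simpa only [hpow, AlgHom.comp_apply] using h3) hj'
  have ha0 : a j ≠ 0 := by rw [haj]; exact RatFunc.algebraMap_ne_zero hpg
  rw [mem_integers, hψ.diffExpand_D_x, HahnSeries.order_mul ((_root_.map_ne_zero ψ).mpr
    (mul_ne_zero ((_root_.map_ne_zero _).mpr ha0) (zpow_ne_zero _ (y_ne_zero hn0)))) (by simp),
    order_monomial hn0 ψ ha0, haj, ← aeval_x, hψ.order_aeval hpg, hψ.order_y,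
    HahnSeries.order_single (by simp), natDegree_mul hp0 (g_ne_zero j), natDegree_g] at h1
  have h2 := degree_identity (l := l) hn0 hdeg j
  zify at h2
  push_cast at h1
  -- The differential `dx` has order `-2` above `∞`, so regularity there reads `deg p + 2 ≤
  -- t^{(j)}`; in particular `j ≠ 0`, since `t^{(0)} = 0`.
  have hdeg_p : p.natDegree + 2 ≤ t n l j := by zify; linarith
  have hj1 : 1 ≤ j := by
    rcases Nat.eq_zero_or_pos j with rfl | h
    · rw [t_zero] at hdeg_p; omega
    · exact h
  have e1 : (algebraMap (RatFunc k) (FunctionField n ρ l) (a j) * (y n ρ l)⁻¹ ^ j) •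
      D k (FunctionField n ρ l) (x n ρ l) =
      ∑ i ∈ Finset.range (p.natDegree + 1), p.coeff i • omega n ρ l j (i + 1) := by
    rw [haj, ← aeval_x, map_mul, aeval_eq_sum_range, Finset.sum_mul, Finset.sum_mul,
      Finset.sum_smul]
    refine Finset.sum_congr rfl fun i _ => ?_
    rw [omega, Nat.add_sub_cancel, ← smul_assoc]
    congr 1
    rw [smul_mul_assoc, smul_mul_assoc, inv_pow, div_eq_mul_inv]
  rw [e1]
  refine Submodule.sum_mem _ fun i hi => Submodule.smul_mem _ _ (Submodule.subset_span ?_)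
  have hi' := Finset.mem_range.mp hi
  exact ⟨⟨(j, i + 1), ⟨hj1, hj'⟩, by simp, by simp; omega⟩, rfl⟩

/-- The classes `h_{μ,ν}` span `H¹(X, 𝒪_X)`. -/
theorem cechClass_mem_span (hn : (n : k) ≠ 0) (hρ : Function.Injective ρ) (hdeg : n ∣ ∑ i, l i)
    (h : regularFunctions (overlap (k := k) (x n ρ l))) :
    cechClass (x n ρ l) h ∈ Submodule.span k (Set.range fun i : Index n l =>
      cechClass (x n ρ l) ⟨regularMonomial n ρ l i.1.1 (-(i.1.2 : ℤ)),
        regularMonomial_mem_overlap hn hρ _ _⟩) := by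
  have hn0 : n ≠ 0 := by rintro rfl; simp at hn
  set S := Submodule.span k (Set.range fun i : Index n l =>
      cechClass (x n ρ l) ⟨regularMonomial n ρ l i.1.1 (-(i.1.2 : ℤ)),
        regularMonomial_mem_overlap hn hρ _ _⟩) with hS
  have hcob : ∀ h : regularFunctions (overlap (k := k) (x n ρ l)),
      h ∈ cechCoboundaries (U (x n ρ l) ((0 : k) : OnePoint k))
        (U (x n ρ l) (OnePoint.infty : OnePoint k)) → cechClass (x n ρ l) h ∈ S := fun h hh => by
    rw [cechClass, Submodule.mkQ_apply, (Submodule.Quotient.mk_eq_zero _).mpr hh]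
    exact zero_mem _
  -- Exponents `j ≥ 0` give functions on `U_∞`, and `j ≤ -t^{(μ)}` functions on `U_0`. Only
  -- `-t^{(μ)} < j < 0` remains, which is empty for `μ = 0`.
  have hmono : ∀ μ < n, ∀ j : ℤ, cechClass (x n ρ l) ⟨regularMonomial n ρ l μ j,
      regularMonomial_mem_overlap hn hρ μ j⟩ ∈ S := by
    intro μ hμ j
    rcases le_or_gt 0 j with hj | hj
    · exact hcob _ ⟨0, zero_mem _, -regularMonomial n ρ l μ j,
        neg_mem (regularMonomial_mem_U_infty hn hρ μ hj), by simp⟩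
    rcases le_or_gt j (-(t n l μ : ℤ)) with hjt | hjt
    · exact hcob _ ⟨regularMonomial n ρ l μ j, regularMonomial_mem_U_zero hn hρ hdeg μ hjt, 0,
        zero_mem _, by simp⟩
    · have hμ1 : 1 ≤ μ := by
        rcases Nat.eq_zero_or_pos μ with rfl | h
        · rw [t_zero] at hjt; simp at hjt; omega
        · exact h
      obtain ⟨ν, rfl⟩ : ∃ ν : ℕ, j = -(ν : ℤ) := ⟨(-j).toNat, by omega⟩
      exact Submodule.subset_span ⟨⟨(μ, ν), ⟨hμ1, hμ⟩, by simp; omega, by simp; omega⟩, rfl⟩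
  obtain ⟨h, hh⟩ := h
  obtain ⟨a, rfl⟩ := exists_sum_pow hn0 h
  have hcomp : ∀ j ∈ Finset.range n, ∃ (p : k[X]) (N : ℕ),
      algebraMap (RatFunc k) (FunctionField n ρ l) (a j) * y n ρ l ^ j =
        ∑ i ∈ Finset.range (p.natDegree + 1),
          p.coeff i • regularMonomial n ρ l j ((i : ℤ) - N) := by
    intro j hj
    obtain ⟨p, N, hp⟩ := exists_eq_div_X_pow fun c hc =>
      denom_eval_ne_zero_of_regular hn hρ (c := c) a (fun P hP => hh P
        ⟨fun h0 => hc ((P.eq_of_sub_mem_nonunits (mem_fiber_coe.mp hP) (mem_fiber_coe.mp h0))),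
          fun h0 => h0 (mem_ring_of_mem_fiber hP)⟩) (Finset.mem_range.mp hj)
    refine ⟨p, N, ?_⟩
    have hg := RatFunc.algebraMap_ne_zero (g_ne_zero (n := n) (ρ := ρ) (l := l) j)
    have hgx := aeval_x_ne_zero (n := n) (ρ := ρ) (l := l)
      (g_ne_zero (n := n) (ρ := ρ) (l := l) j)
    have hx0 : x n ρ l ≠ 0 := x_ne_zero
    have haj : algebraMap (RatFunc k) (FunctionField n ρ l) (a j) =
        aeval (x n ρ l) p / x n ρ l ^ N / aeval (x n ρ l) (g n ρ l j) := by
      rw [eq_div_iff hgx, aeval_x, aeval_x, ← map_mul, hp, map_div₀, map_pow, x_eq]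
    rw [haj, aeval_eq_sum_range, Finset.sum_div, Finset.sum_div, Finset.sum_mul]
    refine Finset.sum_congr rfl fun i _ => ?_
    rw [regularMonomial, algebraMap_X_zpow_div_g, aeval_X, zpow_sub₀ hx0, zpow_natCast,
      zpow_natCast, zpow_natCast, Algebra.smul_def, Algebra.smul_def]
    ring
  choose! p N hpN using hcomp
  have e1 : (⟨_, hh⟩ : regularFunctions (overlap (k := k) (x n ρ l))) =
      ∑ j ∈ Finset.range n, ∑ i ∈ Finset.range ((p j).natDegree + 1),
        (p j).coeff i • ⟨regularMonomial n ρ l j ((i : ℤ) - N j),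
          regularMonomial_mem_overlap hn hρ j _⟩ := by
    ext
    simp only [Submodule.coe_sum, Submodule.coe_smul]
    exact Finset.sum_congr rfl hpN
  rw [e1, map_sum]
  refine Submodule.sum_mem _ fun j hj => ?_
  rw [map_sum]
  refine Submodule.sum_mem _ fun i _ => ?_
  rw [map_smul]
  exact Submodule.smul_mem _ _ (hmono j (Finset.mem_range.mp hj) _)

end Duality

end KummerCurve

end

/-! ### Assembly of the pairing and the dual bases. -/

theorem mainTheorem3 {k : Type*} [Field k] [IsAlgClosed k]
    (n : ℕ) (hn : (n : k) ≠ 0)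
    {r : ℕ} (ρ : Fin r → k) (hρ : Function.Injective ρ)
    (l : Fin r → ℕ) (hl : ∀ i, 0 < l i) (hdeg : n ∣ ∑ i, l i)
    [Fact (Irreducible (KummerCurve.equation n ρ l))] :
    -- the pairing is well defined and bilinear
    ∃ pairing :
        KummerCurve.holomorphicDifferentials k (KummerCurve.FunctionField n ρ l) →ₗ[k]
          KummerCurve.CechH1 (k := k) (KummerCurve.x n ρ l) →ₗ[k] k,
      (∀ (ω : KummerCurve.holomorphicDifferentials k (KummerCurve.FunctionField n ρ l))
          (f : KummerCurve.regularFunctions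
            (KummerCurve.overlap (k := k) (KummerCurve.x n ρ l))),
        pairing ω (KummerCurve.cechClass (KummerCurve.x n ρ l) f) =
          -(1 / (n : k)) *
            ∑ᶠ P ∈ KummerCurve.fiber (KummerCurve.x n ρ l) (OnePoint.infty : OnePoint k),
              KummerCurve.residue P
                ((f : KummerCurve.FunctionField n ρ l) •
                  (ω : Ω[KummerCurve.FunctionField n ρ l⁄k]))) ∧
      -- the differentials and the classes are bases, dual to each other
      ∃ (bω : Module.Basis (KummerCurve.Index n l) k
          (KummerCurve.holomorphicDifferentials k (KummerCurve.FunctionField n ρ l)))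
        (bh : Module.Basis (KummerCurve.Index n l) k
          (KummerCurve.CechH1 (k := k) (KummerCurve.x n ρ l))),
        (∀ i : KummerCurve.Index n l,
          (bω i : Ω[KummerCurve.FunctionField n ρ l⁄k]) =
            KummerCurve.omega n ρ l i.1.1 i.1.2) ∧
        (∀ i : KummerCurve.Index n l,
          ∃ hmem : KummerCurve.hFun n ρ l i.1.1 i.1.2 ∈ KummerCurve.regularFunctions
              (KummerCurve.overlap (k := k) (KummerCurve.x n ρ l)),
            bh i = KummerCurve.cechClass (KummerCurve.x n ρ l)
              ⟨KummerCurve.hFun n ρ l i.1.1 i.1.2, hmem⟩) ∧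
        ∀ i j : KummerCurve.Index n l,
          pairing (bω i) (bh j) = if i = j then (1 : k) else 0 := by

  obtain ⟨ψ, hψ, hw⟩ := KummerCurve.exists_infiniteGerm (n := n) (ρ := ρ) (l := l) hn hdeg
  obtain ⟨pairing, hpair⟩ := KummerCurve.exists_pairing hn hρ hψ
  let vω : KummerCurve.Index n l →
      KummerCurve.holomorphicDifferentials k (KummerCurve.FunctionField n ρ l) := fun i =>
    ⟨KummerCurve.omega n ρ l i.1.1 i.1.2, KummerCurve.omega_mem hn hρ hdeg i.2.2.1 i.2.2.2⟩
  have hmem : ∀ i : KummerCurve.Index n l, KummerCurve.hFun n ρ l i.1.1 i.1.2 ∈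
      KummerCurve.regularFunctions (KummerCurve.overlap (k := k) (KummerCurve.x n ρ l)) :=
    fun i => by
      rw [KummerCurve.hFun_eq]
      exact KummerCurve.regularMonomial_mem_overlap hn hρ _ _
  let vh : KummerCurve.Index n l → KummerCurve.CechH1 (k := k) (KummerCurve.x n ρ l) := fun i =>
    KummerCurve.cechClass (KummerCurve.x n ρ l) ⟨_, hmem i⟩
  have hdual : ∀ i j, pairing (vω i) (vh j) = if i = j then (1 : k) else 0 := fun i j => by
    rw [hpair]
    exact KummerCurve.residuePairing_omega_hFun hn hψ i j
  -- Each family serves, through the pairing, as a system of dual functionals for the other, so both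
  -- are independent.
  have hiω : LinearIndependent k vω :=
    LinearIndependent.of_pairwise_dual_eq_zero_one vω (fun j => pairing.flip (vh j))
      (fun j i hji => (hdual i j).trans (if_neg hji.symm))
      (fun i => (hdual i i).trans (if_pos rfl))
  have hih : LinearIndependent k vh :=
    LinearIndependent.of_pairwise_dual_eq_zero_one vh (fun i => pairing (vω i))
      (fun i j hij => (hdual i j).trans (if_neg hij))
      (fun i => (hdual i i).trans (if_pos rfl))
  have hsω : ⊤ ≤ Submodule.span k (Set.range vω) := by
    rintro ⟨η, hη⟩ -
    have h1 := KummerCurve.mem_span_omega hn hρ hdeg hη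
    have h2 : (Set.range fun i : KummerCurve.Index n l => KummerCurve.omega n ρ l i.1.1 i.1.2) =
        Submodule.subtype _ '' Set.range vω := by
      rw [← Set.range_comp]
      rfl
    rw [h2, Submodule.span_image] at h1
    obtain ⟨η', hη', heq⟩ := h1
    have : η' = ⟨η, hη⟩ := Subtype.ext heq
    exact this ▸ hη'
  have hsh : ⊤ ≤ Submodule.span k (Set.range vh) := by
    rintro h -
    obtain ⟨h, rfl⟩ := Submodule.mkQ_surjective _ h
    have h1 := KummerCurve.cechClass_mem_span hn hρ hdeg h
    have h2 : (fun i : KummerCurve.Index n l => KummerCurve.cechClass (KummerCurve.x n ρ l)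
        ⟨KummerCurve.regularMonomial n ρ l i.1.1 (-(i.1.2 : ℤ)),
          KummerCurve.regularMonomial_mem_overlap hn hρ _ _⟩) = vh := by
      funext i
      simp only [vh, KummerCurve.hFun_eq]
    rw [h2] at h1
    exact h1
  refine ⟨pairing, fun ω f => ?_, Module.Basis.mk hiω hsω, Module.Basis.mk hih hsh, fun i => ?_,
    fun i => ⟨hmem i, ?_⟩, fun i j => ?_⟩
  · rw [hpair, hψ.finsum_residue hn hdeg hw]
    rfl
  · rw [Module.Basis.mk_apply]
  · rw [Module.Basis.mk_apply]
  · rw [Module.Basis.mk_apply, Module.Basis.mk_apply, hdual]
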